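/- **Conventions.** Let $\Sigma$ be an alphabet (a finite non-empty set), $w\ge 1$, and let $\tau=(R_1,\dots,R_\ell)$ be a relational vocabulary, $R_i$ having arity $a_i\ge 1$. Write $\square$ for a padding symbol not in the alphabet at hand, and $\Sigma^{\otimes a}$ for the alphabet of $a$-tuples of symbols of $\Sigma$. The tensor product $s_1\otimes\dots\otimes s_a$ of non-empty strings is the string of length $\max_i|s_i|$ whose $j$-th letter is the tuple of the $j$-th letters of $s_1,\dots,s_a$, with $\square$ in place of missing letters; for a language $L$ let $L^{\otimes a}=\{s_1\otimes\dots\otimes s_a : s_1,\dots,s_a\in L\}$. For an alphabet $\Delta$, a *$(\Delta,w)$-layer* is a tuple $B=(\ell,r,T,I,F,\iota,\phi)$ with $\ell,r\subseteq\{0,\dots,w-1\}$, $T\subseteq \ell\times(\Delta\sqcup\{\square\})\times r$, $I\subseteq\ell$, $F\subseteq r$, and Boolean flags $\iota,\phi$ such that $I=\emptyset$ if $\iota$ is false and $F=\emptyset$ if $\phi$ is false. Let $\mathcal B(\Delta,w)$ be the finite alphabet of all $(\Delta,w)$-layers. A *$(\Delta,w)$-ODD of length $k\ge1$* is a string $B_1\cdots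 B_k$ of $(\Delta,w)$-layers such that the left states of $B_{i+1}$ are the right states of $B_i$ for $1\le i<k$, the flag $\iota(B_i)$ is true iff $i=1$, and the flag $\phi(B_i)$ is true iff $i=k$. Its language consists of all strings $\sigma_1\cdots\sigma_{k'}$ over $\Delta$ with $1\le k'\le k$ for which there are states $q_0,\dots,q_k$ with $q_0\in I(B_1)$, $q_k\in F(B_k)$ and $(q_{i-1},\sigma_i,q_i)\in T(B_i)$ for all $1\le i\le k$, where $\sigma_i=\square$ for $i>k'$. A tuple $\mathbf D=(D_0,\dots,D_\ell)$ is *$(\Sigma,w,\tau)$-structural* if, for some $k\ge 1$, $D_0$ is a $(\Sigma,w)$-ODD of length $k$, each $D_i$ ($1\le i\le\ell$) is a $(\Sigma^{\otimes a_i},w)$-ODD of length $k$, and $L(D_i)\subseteq L(D_0)^{\otimes a_i}$. When $L(D_0)\neq\emptyset$, the *derived structure* $\mathfrak s(\mathbf D)$ is the $\tau$-structure with domain $L(D_0)$ in which $R_i$ is interpreted as the set of tuples $(s_1,\dots,s_{a_i})$ with $s_1\otimes\dots\otimes s_{a_i}\in L(D_i)$. Let $\Gamma=\mathcal B(\Sigma,w)\times\mathcal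 B(\Sigma^{\otimes a_1},w)\times\dots\times\mathcal B(\Sigma^{\otimes a_\ell},w)$. For ODDs $D_0,\dots,D_\ell$ of the same length $k$, $D_0\otimes\dots\otimes D_\ell$ is a string of length $k$ over $\Gamma$. A string over $\Gamma$ is viewed as a structure on its set of positions, with the order of the positions and one unary predicate for each letter of $\Gamma$. **Theorem.** Let $\Sigma$ be an alphabet, $w\ge1$ and $\tau=(R_1,\dots,R_\ell)$ a relational vocabulary. The following problem is decidable: given a monadic second-order sentence $\psi$ over the vocabulary of strings over $\Gamma$ and a first-order $\tau$-sentence $\varphi$, is there a string $S=D_0\otimes D_1\otimes\dots\otimes D_\ell$ over $\Gamma$ such that $\mathbf D=(D_0,D_1,\dots,D_\ell)$ is a $(\Sigma,w,\tau)$-structural tuple with $L(D_0)\ne\emptyset$, $S\models\psi$, and $\mathfrak s(\mathbf D)\models\varphi$? -/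

import Mathlib

universe u v x

/-! ### Layers and ordered decision diagrams -/

/-- An `(A, w)`-layer. States are elements of `{0, …, w - 1}`; transitions are labelled by
`A ⊔ {□}`, where the padding symbol `□` is `none : Option A`. -/
@[ext] structure Layer (A : Type u) (w : ℕ) where
  left : Set (Fin w)
  right : Set (Fin w)
  trans : Set (Fin w × Option A × Fin w)
  init : Set (Fin w)
  final : Set (Fin w)
  initFlag : Bool
  finalFlag : Bool
  trans_subset : ∀ p a q, (p, a, q) ∈ trans → p ∈ left ∧ q ∈ right
  init_subset : init ⊆ left
  final_subset : final ⊆ right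
  init_eq_empty : initFlag = false → init = ∅
  final_eq_empty : finalFlag = false → final = ∅

instance Layer.instFinite {A : Type u} [Finite A] {w : ℕ} : Finite (Layer A w) :=
  Finite.of_injective
    (fun l : Layer A w =>
      (l.left, l.right, l.trans, l.init, l.final, l.initFlag, l.finalFlag))
    (fun l l' h => by
      simp only [Prod.mk.injEq] at h
      obtain ⟨h1, h2, h3, h4, h5, h6, h7⟩ := h
      exact Layer.ext h1 h2 h3 h4 h5 h6 h7)

/-- A string of `k` layers (given as a map on its positions) is an ordered decision diagram of
length `k ≥ 1`. -/
structure IsODD {A : Type u} {w k : ℕ} (D : Fin k → Layer A w) : Prop where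
  pos : 0 < k
  frontier : ∀ i j : Fin k, (i : ℕ) + 1 = j → (D j).left = (D i).right
  initFlag : ∀ i : Fin k, (D i).initFlag = true ↔ (i : ℕ) = 0
  finalFlag : ∀ i : Fin k, (D i).finalFlag = true ↔ (i : ℕ) + 1 = k

/-- The language of an ODD of length `k`: the non-empty strings of length at most `k` that have an
accepting sequence. The sequence of transitions is given by the states `r 0, …, r k` it visits;
the label at position `i` is the `i`-th letter of `s`, and `□` (`none`) beyond the end of `s`. -/
def oddLang {A : Type u} {w k : ℕ} (D : Fin k → Layer A w) : Set (List A) :=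
  {s | s ≠ [] ∧ s.length ≤ k ∧ ∃ r : Fin (k + 1) → Fin w,
    (∀ i : Fin k, (r i.castSucc, s[(i : ℕ)]?, r i.succ) ∈ (D i).trans) ∧
    (∀ i : Fin k, (i : ℕ) = 0 → r i.castSucc ∈ (D i).init) ∧
    (∀ i : Fin k, (i : ℕ) + 1 = k → r i.succ ∈ (D i).final)}

/-! ### Tensor products of strings -/

/-- The tensor product (convolution) of the strings `s 0, …, s (a - 1)`: its length is the maximum
of their lengths, and shorter strings are padded with `□` (`none`). -/
def tensorStr {A : Type u} {a : ℕ} (s : Fin a → List A) : List (Fin a → Option A) :=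
  List.ofFn fun (j : Fin (Finset.univ.sup fun i => (s i).length)) i => (s i)[(j : ℕ)]?

/-- A string over the tensor power `A^{⊗a}`, seen as a string over `(A ⊔ {□})^{⊗a}`. -/
def embedStr {A : Type u} {a : ℕ} (t : List (Fin a → A)) : List (Fin a → Option A) :=
  t.map fun c i => some (c i)

/-- The tensor power `L^{⊗a}` of a language. -/
def tensorPow {A : Type u} (L : Set (List A)) (a : ℕ) : Set (List (Fin a → Option A)) :=
  {t | ∃ s : Fin a → List A, (∀ i, s i ∈ L) ∧ t = tensorStr s}

/-- The relation associated with a language over `A^{⊗a}`: all tuples of non-empty strings whose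
tensor product lies in the language. -/
def assocRel {A : Type u} {a : ℕ} (L : Set (List (Fin a → A))) : Set (Fin a → List A) :=
  {s | (∀ i, s i ≠ []) ∧ ∃ t ∈ L, tensorStr s = embedStr t}

/-! ### Relational vocabularies, structural tuples and derived structures -/

/-- A relational vocabulary: finitely many relation symbols of positive arities. -/
structure Vocabulary where
  numRel : ℕ
  arity : Fin numRel → ℕ
  arity_pos : ∀ i, 0 < arity i

/-- The relation symbols of a vocabulary, indexed by their arity. -/
inductive Vocabulary.Rel (τ : Vocabulary) : ℕ → Type
  | mk (i : Fin τ.numRel) : Vocabulary.Rel τ (τ.arity i)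

/-- The first-order language of a vocabulary. -/
def Vocabulary.language (τ : Vocabulary) : FirstOrder.Language.{0, 0} where
  Functions := fun _ => Empty
  Relations := τ.Rel

instance Vocabulary.instIsRelational (τ : Vocabulary) : τ.language.IsRelational :=
  fun _ => inferInstanceAs (IsEmpty Empty)

/-- The alphabet of tuples of layers: one `(A, w)`-layer, and for each relation symbol of arity `a`
one `(A^{⊗a}, w)`-layer. -/
abbrev StructLayer (A : Type u) (w : ℕ) (τ : Vocabulary) : Type u :=
  Layer A w × ((i : Fin τ.numRel) → Layer (Fin (τ.arity i) → A) w)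

/-- The component `D₀` of the string `S = D₀ ⊗ D₁ ⊗ … ⊗ Dₗ`. -/
def domODD {A : Type u} {w : ℕ} {τ : Vocabulary} {k : ℕ} (S : Fin k → StructLayer A w τ) :
    Fin k → Layer A w :=
  fun j => (S j).1

/-- The component of the string `S = D₀ ⊗ D₁ ⊗ … ⊗ Dₗ` that belongs to the relation symbol `i`. -/
def relODD {A : Type u} {w : ℕ} {τ : Vocabulary} {k : ℕ} (S : Fin k → StructLayer A w τ)
    (i : Fin τ.numRel) : Fin k → Layer (Fin (τ.arity i) → A) w :=
  fun j => (S j).2 i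

/-- The components of `S` form an `(A, w, τ)`-structural tuple of ODDs, of length `k ≥ 1`. -/
structure IsStructural {A : Type u} {w : ℕ} {τ : Vocabulary} {k : ℕ}
    (S : Fin k → StructLayer A w τ) : Prop where
  dom : IsODD (domODD S)
  rel : ∀ i, IsODD (relODD S i)
  subset : ∀ i, embedStr '' oddLang (relODD S i) ⊆ tensorPow (oddLang (domODD S)) (τ.arity i)

/-- The structure derived from the tuple of components of `S`: its domain is the language of the
ODD `D₀`, its relations are those associated with the languages of the other ODDs. -/
@[reducible] def derivedStructure {A : Type u} {w : ℕ} {τ : Vocabulary} {k : ℕ}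
    (S : Fin k → StructLayer A w τ) : τ.language.Structure (oddLang (domODD S)) where
  funMap := fun f => Empty.elim f
  RelMap := fun R => match R with
    | .mk i => fun xs => (fun j => (xs j : List A)) ∈ assocRel (oddLang (relODD S i))

/-- The structure derived from the components of `S` satisfies the first-order sentence `φ`. -/
def DerivedModels {A : Type u} {w : ℕ} {τ : Vocabulary} {k : ℕ}
    (S : Fin k → StructLayer A w τ) (φ : τ.language.Sentence) : Prop :=
  letI := derivedStructure S
  FirstOrder.Language.Sentence.Realize (oddLang (domODD S)) φ

/-! ### Monadic second-order logic -/

/-- Monadic second-order formulas over a relational language `L`, with `n` free first-order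
variables and `m` free set variables (in the style of `FirstOrder.Language.BoundedFormula`: a
quantifier binds the variable with the largest index). -/
inductive MSO (L : FirstOrder.Language.{u, v}) : ℕ → ℕ → Type v
  | falsum {n m : ℕ} : MSO L n m
  | equal {n m : ℕ} (x y : Fin n) : MSO L n m
  | rel {n m k : ℕ} (R : L.Relations k) (xs : Fin k → Fin n) : MSO L n m
  | mem {n m : ℕ} (x : Fin n) (X : Fin m) : MSO L n m
  | imp {n m : ℕ} (φ ψ : MSO L n m) : MSO L n m
  | all {n m : ℕ} (φ : MSO L (n + 1) m) : MSO L n m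
  | allSet {n m : ℕ} (φ : MSO L n (m + 1)) : MSO L n m

/-- Satisfaction of a monadic second-order formula. -/
def MSO.Realize {L : FirstOrder.Language.{u, v}} {M : Type x} [L.Structure M] :
    {n m : ℕ} → MSO L n m → (Fin n → M) → (Fin m → Set M) → Prop
  | _, _, .falsum, _, _ => False
  | _, _, .equal x y, e, _ => e x = e y
  | _, _, .rel R xs, e, _ => FirstOrder.Language.Structure.RelMap R fun j => e (xs j)
  | _, _, .mem x X, e, E => e x ∈ E X
  | _, _, .imp φ ψ, e, E => φ.Realize e E → ψ.Realize e E
  | _, _, .all φ, e, E => ∀ a : M, φ.Realize (Fin.snoc e a) E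
  | _, _, .allSet φ, e, E => ∀ B : Set M, φ.Realize e (Fin.snoc E B)

/-- Monadic second-order sentences. -/
abbrev MSO.Sentence (L : FirstOrder.Language.{u, v}) : Type v := MSO L 0 0

/-- The relation symbols of the vocabulary of strings over `G`: the order of positions, and for
each letter a unary predicate. -/
inductive StringRel (G : Type u) : ℕ → Type u
  | lt : StringRel G 2
  | letter (c : G) : StringRel G 1

/-- The vocabulary of strings over `G`. -/
def stringLanguage (G : Type u) : FirstOrder.Language.{0, u} where
  Functions := fun _ => Empty
  Relations := StringRel G

/-- A string of length `k`, as a structure on the set of its positions. -/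
@[reducible] def stringStructure {G : Type u} {k : ℕ} (S : Fin k → G) :
    (stringLanguage G).Structure (Fin k) where
  funMap := fun f => Empty.elim f
  RelMap := fun R => match R with
    | .lt => fun p => p 0 < p 1
    | .letter c => fun p => S (p 0) = c

/-- The string `S` satisfies the monadic second-order sentence `ψ`. -/
def StringModels {G : Type u} {k : ℕ} (S : Fin k → G) (ψ : MSO.Sentence (stringLanguage G)) :
    Prop :=
  letI := stringStructure S
  ψ.Realize (M := Fin k) Fin.elim0 Fin.elim0

/-! ### Gödel numbers of formulas -/

/-- The Gödel number of a monadic second-order formula, for a numbering `c` of the relation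
symbols. -/
def MSO.code {L : FirstOrder.Language.{u, v}} (c : (k : ℕ) → L.Relations k → ℕ) :
    {n m : ℕ} → MSO L n m → ℕ
  | _, _, .falsum => Nat.pair 0 0
  | _, _, .equal x y => Nat.pair 1 (Nat.pair x y)
  | _, _, .rel (k := k) R xs =>
      Nat.pair 2 (Nat.pair (c k R) (Encodable.encode (List.ofFn fun j => (xs j : ℕ))))
  | _, _, .imp φ ψ => Nat.pair 3 (Nat.pair (φ.code c) (ψ.code c))
  | _, _, .all φ => Nat.pair 4 (φ.code c)
  | _, _, .mem x X => Nat.pair 5 (Nat.pair x X)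
  | _, _, .allSet φ => Nat.pair 6 (φ.code c)

/-- The index of the variable that is a term of a relational language. -/
def termCode {L : FirstOrder.Language.{u, v}} [L.IsRelational] {n : ℕ} : L.Term (Empty ⊕ Fin n) → ℕ
  | .var (.inl z) => z.elim
  | .var (.inr x) => x
  | .func f _ => isEmptyElim f

/-- The Gödel number of a first-order formula over a relational language, for a numbering `c` of
the relation symbols. -/
def foCode {L : FirstOrder.Language.{u, v}} [L.IsRelational] (c : (k : ℕ) → L.Relations k → ℕ) :
    {n : ℕ} → L.BoundedFormula Empty n → ℕ
  | _, .falsum => Nat.pair 0 0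
  | _, .equal s t => Nat.pair 1 (Nat.pair (termCode s) (termCode t))
  | _, .rel (l := k) R ts =>
      Nat.pair 2 (Nat.pair (c k R) (Encodable.encode (List.ofFn fun j => termCode (ts j))))
  | _, .imp φ ψ => Nat.pair 3 (Nat.pair (foCode c φ) (foCode c ψ))
  | _, .all φ => Nat.pair 4 (foCode c φ)

/-- The number of a relation symbol of a vocabulary is its position in the vocabulary. -/
def vocabRelCode (τ : Vocabulary) (k : ℕ) : τ.language.Relations k → ℕ
  | .mk i => i

/-- A numbering of the symbols of the vocabulary of strings over a finite alphabet: `0` for the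
order, and `1, 2, …` for the letters, in a fixed enumeration of the alphabet. -/
noncomputable def stringRelCode (G : Type u) [Finite G] (k : ℕ) :
    (stringLanguage G).Relations k → ℕ
  | .lt => 0
  | .letter c => (Finite.equivFin G c : ℕ) + 1

/-- The Gödel number of a monadic second-order sentence over strings. -/
noncomputable def msoNumber {G : Type u} [Finite G] (ψ : MSO.Sentence (stringLanguage G)) : ℕ :=
  ψ.code (stringRelCode G)

/-- The Gödel number of a first-order sentence over a relational vocabulary. -/
def foNumber {τ : Vocabulary} (φ : τ.language.Sentence) : ℕ :=
  foCode (vocabRelCode τ) φ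

/-!
The proof reduces the problem to a bounded search. Positions, sets of positions and elements of the
derived structure are all represented by strings of the same length `k` as the given string `S`:
characteristic strings for positions and sets, and padded strings for elements. In this
representation the atomic formulas of both logics, the relativization of the first-order
quantifiers and the condition that `S` is structural can be recognized by finite automata that read
`S` and the values of the variables in parallel (`recognizable_msoInterp`,
`recognizable_foInterp`, `recognizable_isStructural`). The inclusion `L(Dᵢ) ⊆ L(D₀)^{⊗a}` becomes
tractable because a tensor product without padding is a transposition of strings of equal length
(`tensorStr_eq_embedStr_iff`).

Hence both logics are instances of one logic with string-valued variables, whose satisfaction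
relation `Interp.Sat` is defined by recursion on Gödel numbers. Product, complement and the subset
construction give an automaton for every formula, and the number of its states is bounded by a
primitive recursive function of the Gödel number alone (`Interp.recognizedBy_sat`). By pumping, if
there is a suitable string at all, then there is one whose length is at most the number of states
(`RecognizedBy.exists_le`). So no automaton has to be computed from the formulas: it is enough to
evaluate the two sentences on all strings up to the bound. This evaluation is primitive recursive
(`Interp.primrecPred_sat`), strings being represented by the digits of natural numbers.
-/

/-! ### Predicates on strings recognized by finite automata -/

section Recognizability

variable {X : Type*} {Y : Type*}

/-- The predicate `Q` on strings over `X` (given as maps on their positions) is recognized by a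
deterministic finite automaton with at most `N` states. The alphabet `X` may be infinite. -/
def RecognizedBy (N : ℕ) (Q : (k : ℕ) → (Fin k → X) → Prop) : Prop :=
  ∃ (σ : Type) (_ : Fintype σ) (M : DFA X σ), Fintype.card σ ≤ N ∧
    ∀ k (W : Fin k → X), Q k W ↔ List.ofFn W ∈ M.accepts

/-- The predicate `Q` on strings is recognized by some deterministic finite automaton. -/
def Recognizable (Q : (k : ℕ) → (Fin k → X) → Prop) : Prop :=
  ∃ N, RecognizedBy N Q

/-- A predicate that depends only on a finite amount of information `st W` about the string `W`,
where `st` can be updated letter by letter, is recognized by an automaton. -/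
theorem RecognizedBy.of_state {σ : Type*} [Finite σ] {Q : (k : ℕ) → (Fin k → X) → Prop}
    (st : (k : ℕ) → (Fin k → X) → σ) (start : σ) (step : σ → X → σ) (acc : Set σ)
    (h0 : ∀ W, st 0 W = start)
    (hs : ∀ k (W : Fin (k + 1) → X), st (k + 1) W = step (st k (Fin.init W)) (W (Fin.last k)))
    (hQ : ∀ k W, Q k W ↔ st k W ∈ acc) : RecognizedBy (Nat.card σ) Q := by
  let e := Finite.equivFin σ
  refine ⟨Fin (Nat.card σ), inferInstance, DFA.reindex e ⟨step, start, acc⟩, by simp, ?_⟩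
  intro k W
  rw [DFA.accepts_reindex, hQ, DFA.mem_accepts]
  have : ∀ k (W : Fin k → X), (⟨step, start, acc⟩ : DFA X σ).eval (List.ofFn W) = st k W := by
    intro k
    induction k with
    | zero => intro W; simp [h0]
    | succ k ih =>
      intro W
      rw [List.ofFn_succ', List.concat_eq_append, DFA.eval_append_singleton, hs, ← ih]
      rfl
  rw [this]

theorem RecognizedBy.mono {N N' : ℕ} (h : N ≤ N') {Q : (k : ℕ) → (Fin k → X) → Prop}
    (hQ : RecognizedBy N Q) : RecognizedBy N' Q :=
  let ⟨σ, i, M, hM, hQ⟩ := hQ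
  ⟨σ, i, M, hM.trans h, hQ⟩

theorem RecognizedBy.congr {N : ℕ} {Q Q' : (k : ℕ) → (Fin k → X) → Prop}
    (hQ : RecognizedBy N Q) (h : ∀ k W, Q' k W ↔ Q k W) : RecognizedBy N Q' :=
  let ⟨σ, i, M, hM, hQ⟩ := hQ
  ⟨σ, i, M, hM, fun k W => (h k W).trans (hQ k W)⟩

theorem RecognizedBy.not {N : ℕ} {Q : (k : ℕ) → (Fin k → X) → Prop}
    (hQ : RecognizedBy N Q) : RecognizedBy N fun k W => ¬ Q k W := by
  obtain ⟨σ, i, M, hM, hQ⟩ := hQ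
  refine ⟨σ, i, Mᶜ, hM, fun k W => ?_⟩
  beta_reduce
  rw [hQ, DFA.accepts_compl]
  rfl

theorem RecognizedBy.and {N N' : ℕ} {Q Q' : (k : ℕ) → (Fin k → X) → Prop}
    (hQ : RecognizedBy N Q) (hQ' : RecognizedBy N' Q') :
    RecognizedBy (N * N') fun k W => Q k W ∧ Q' k W := by
  obtain ⟨σ, i, M, hM, hQ⟩ := hQ
  obtain ⟨σ', i', M', hM', hQ'⟩ := hQ'
  refine ⟨σ × σ', inferInstance, M.inter M', ?_, fun k W => ?_⟩
  · rw [Fintype.card_prod]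
    exact Nat.mul_le_mul hM hM'
  · beta_reduce
    rw [hQ, hQ', DFA.accepts_inter]
    rfl

theorem RecognizedBy.imp {N N' : ℕ} {Q Q' : (k : ℕ) → (Fin k → X) → Prop}
    (hQ : RecognizedBy N Q) (hQ' : RecognizedBy N' Q') :
    RecognizedBy (N * N') fun k W => Q k W → Q' k W :=
  (hQ.and hQ'.not).not.congr fun k W => by tauto

theorem RecognizedBy.comap {N : ℕ} {Q : (k : ℕ) → (Fin k → X) → Prop} (f : Y → X)
    (hQ : RecognizedBy N Q) : RecognizedBy N fun k W => Q k fun j => f (W j) := by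
  obtain ⟨σ, i, M, hM, hQ⟩ := hQ
  refine ⟨σ, i, M.comap f, hM, fun k W => ?_⟩
  beta_reduce
  rw [hQ, DFA.accepts_comap]
  change _ ↔ List.map f (List.ofFn W) ∈ M.accepts
  rw [List.map_ofFn]
  rfl

/-- Projection, by the subset construction. -/
theorem RecognizedBy.exists {N : ℕ} {Q : (k : ℕ) → (Fin k → X × Y) → Prop}
    (hQ : RecognizedBy N Q) :
    RecognizedBy (2 ^ N) fun k W => ∃ V : Fin k → Y, Q k fun j => (W j, V j) := by
  obtain ⟨σ, i, M, hM, hQ⟩ := hQ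
  have h : RecognizedBy (Nat.card (Set σ))
      (fun k (W : Fin k → X) => ∃ V : Fin k → Y, Q k fun j => (W j, V j)) := by
    refine RecognizedBy.of_state
      (fun k W => {s | ∃ V : Fin k → Y, s = M.eval (List.ofFn fun j => (W j, V j))})
      {M.start} (fun T c => {s | ∃ t ∈ T, ∃ y, s = M.step t (c, y)})
      {T | ∃ s ∈ T, s ∈ M.accept} ?_ ?_ ?_
    · intro W
      ext s
      simp
    · intro k W
      ext s
      simp only [Set.mem_ofPred_eq, List.ofFn_succ', List.concat_eq_append,
        DFA.eval_append_singleton]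
      constructor
      · rintro ⟨V, rfl⟩
        exact ⟨_, ⟨Fin.init V, rfl⟩, V (Fin.last k), rfl⟩
      · rintro ⟨_, ⟨V, rfl⟩, y, rfl⟩
        exact ⟨Fin.snoc V y, by simp [Fin.init]⟩
    · intro k W
      constructor
      · rintro ⟨V, hV⟩
        exact ⟨_, ⟨V, rfl⟩, (hQ k _).1 hV⟩
      · rintro ⟨_, ⟨V, rfl⟩, hV⟩
        exact ⟨V, (hQ k _).2 hV⟩
  refine h.mono ?_
  rw [Nat.card_eq_fintype_card, Fintype.card_set]
  exact Nat.pow_le_pow_right two_pos hM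

theorem RecognizedBy.forall {N : ℕ} {Q : (k : ℕ) → (Fin k → X × Y) → Prop}
    (hQ : RecognizedBy N Q) :
    RecognizedBy (2 ^ N) fun k W => ∀ V : Fin k → Y, Q k fun j => (W j, V j) :=
  hQ.not.exists.not.congr fun k W => by simp

theorem RecognizedBy.false : RecognizedBy 1 fun k (_ : Fin k → X) => False :=
  (RecognizedBy.of_state (σ := Unit) (fun _ _ => ()) () (fun _ _ => ()) ∅ (fun _ => rfl)
    (fun _ _ => rfl) (by simp)).mono (by simp)

/-- Pumping: if a recognized predicate holds of some string, then it holds of a string no longer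
than the number of states. -/
theorem RecognizedBy.exists_le {N : ℕ} {Q : (k : ℕ) → (Fin k → X) → Prop}
    (hQ : RecognizedBy N Q) {k : ℕ} {W : Fin k → X} (hW : Q k W) :
    ∃ k' ≤ N, ∃ W' : Fin k' → X, Q k' W' := by
  induction k using Nat.strong_induction_on with
  | _ k ih =>
    by_cases hk : k ≤ N
    · exact ⟨k, hk, W, hW⟩
    obtain ⟨σ, i, M, hM, hQM⟩ := id hQ
    obtain ⟨a, b, c, habc, -, hb, hsub⟩ := M.pumping_lemma ((hQM k W).1 hW)
      (by rw [List.length_ofFn]; omega)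
    have hac : a ++ c ∈ M.accepts := by
      refine hsub (Language.mem_mul.2 ⟨a, ?_, c, rfl, rfl⟩)
      exact Language.mem_mul.2 ⟨a, rfl, [], Language.nil_mem_kstar _, by simp⟩
    have hlen := congrArg List.length habc
    simp only [List.length_ofFn, List.length_append] at hlen
    have hb' := List.length_pos_iff.2 hb
    refine ih (a ++ c).length (by rw [List.length_append]; omega) (W := (a ++ c).get) ?_
    rw [hQM, List.ofFn_get]
    exact hac

theorem Recognizable.congr {Q Q' : (k : ℕ) → (Fin k → X) → Prop} (hQ : Recognizable Q)
    (h : ∀ k W, Q' k W ↔ Q k W) : Recognizable Q' :=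
  let ⟨N, hN⟩ := hQ
  ⟨N, hN.congr h⟩

theorem Recognizable.not {Q : (k : ℕ) → (Fin k → X) → Prop} (hQ : Recognizable Q) :
    Recognizable fun k W => ¬ Q k W :=
  let ⟨N, hN⟩ := hQ
  ⟨N, hN.not⟩

theorem Recognizable.and {Q Q' : (k : ℕ) → (Fin k → X) → Prop} (hQ : Recognizable Q)
    (hQ' : Recognizable Q') : Recognizable fun k W => Q k W ∧ Q' k W :=
  let ⟨_, hN⟩ := hQ
  let ⟨_, hN'⟩ := hQ'
  ⟨_, hN.and hN'⟩

theorem Recognizable.imp {Q Q' : (k : ℕ) → (Fin k → X) → Prop} (hQ : Recognizable Q)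
    (hQ' : Recognizable Q') : Recognizable fun k W => Q k W → Q' k W :=
  let ⟨_, hN⟩ := hQ
  let ⟨_, hN'⟩ := hQ'
  ⟨_, hN.imp hN'⟩

theorem Recognizable.comap {Q : (k : ℕ) → (Fin k → X) → Prop} (f : Y → X) (hQ : Recognizable Q) :
    Recognizable fun k W => Q k fun j => f (W j) :=
  let ⟨N, hN⟩ := hQ
  ⟨N, hN.comap f⟩

theorem Recognizable.exists {Q : (k : ℕ) → (Fin k → X × Y) → Prop} (hQ : Recognizable Q) :
    Recognizable fun k W => ∃ V : Fin k → Y, Q k fun j => (W j, V j) :=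
  let ⟨_, hN⟩ := hQ
  ⟨_, hN.exists⟩

theorem Recognizable.forall {Q : (k : ℕ) → (Fin k → X × Y) → Prop} (hQ : Recognizable Q) :
    Recognizable fun k W => ∀ V : Fin k → Y, Q k fun j => (W j, V j) :=
  let ⟨_, hN⟩ := hQ
  ⟨_, hN.forall⟩

theorem Recognizable.false : Recognizable fun k (_ : Fin k → X) => False :=
  ⟨1, RecognizedBy.false⟩

theorem Recognizable.forall_finite {ι : Type*} [Finite ι] {Q : ι → (k : ℕ) → (Fin k → X) → Prop}
    (hQ : ∀ i, Recognizable (Q i)) : Recognizable fun k W => ∀ i, Q i k W := by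
  have h : ∀ s : Finset ι, Recognizable fun k W => ∀ i ∈ s, Q i k W := by
    classical
    intro s
    induction s using Finset.induction_on with
    | empty => exact Recognizable.false.not.congr fun k W => by simp
    | insert a s _ ih => exact ((hQ a).and ih).congr fun k W => by simp
  have := Fintype.ofFinite ι
  exact (h Finset.univ).congr fun k W => by simp

/-! ### Local conditions on strings -/

theorem Recognizable.all (P : X → Prop) : Recognizable fun k (W : Fin k → X) => ∀ j, P (W j) :=
  ⟨_, RecognizedBy.of_state (fun k W => ∀ j, P (W j)) True (fun q c => q ∧ P c) {q | q}
    (fun W => by simp) (fun k W => by simp [Fin.forall_fin_succ', Fin.init]) (fun k W => Iff.rfl)⟩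

theorem Recognizable.any (P : X → Prop) : Recognizable fun k (W : Fin k → X) => ∃ j, P (W j) :=
  (Recognizable.all fun c => ¬ P c).not.congr fun k W => by simp

/-- Some position with `P` is followed, not necessarily immediately, by a position with `R`. -/
theorem Recognizable.any_lt (P R : X → Prop) :
    Recognizable fun k (W : Fin k → X) => ∃ i j, i < j ∧ P (W i) ∧ R (W j) :=
  ⟨_, RecognizedBy.of_state
    (fun k W => ((∃ j, P (W j) : Prop), (∃ i j, i < j ∧ P (W i) ∧ R (W j) : Prop)))
    (False, False) (fun q c => (q.1 ∨ P c, q.2 ∨ q.1 ∧ R c)) {q | q.2}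
    (fun W => by simp)
    (fun k W => by
      simp only [Fin.exists_fin_succ', Fin.init, Fin.castSucc_lt_castSucc_iff,
        Fin.castSucc_lt_last, lt_irrefl, false_and, or_false, true_and, Prod.mk.injEq, true_and,
        eq_iff_iff]
      have : ∀ j : Fin k, ¬ Fin.last k < j.castSucc := fun j => by
        simpa using (Fin.castSucc_lt_last j).le
      simp only [this, false_and, exists_false, or_false]
      rw [← exists_and_right, ← exists_or])
    (fun k W => Iff.rfl)⟩

theorem Recognizable.first (P : X → Prop) :
    Recognizable fun k (W : Fin k → X) => ∀ i : Fin k, (i : ℕ) = 0 → P (W i) :=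
  ⟨_, RecognizedBy.of_state
    (fun k W => ((k = 0 : Prop), (∀ i : Fin k, (i : ℕ) = 0 → P (W i) : Prop)))
    (True, True) (fun q c => (False, q.2 ∧ (q.1 → P c))) {q | q.2}
    (fun W => by simp)
    (fun k W => Prod.ext (by simp) (by
      simp only [Fin.forall_fin_succ', Fin.init, Fin.val_castSucc, Fin.val_last]))
    (fun k W => Iff.rfl)⟩

theorem Recognizable.last (P : X → Prop) :
    Recognizable fun k (W : Fin k → X) => ∀ i : Fin k, (i : ℕ) + 1 = k → P (W i) :=
  ⟨_, RecognizedBy.of_state (fun k W => ∀ i : Fin k, (i : ℕ) + 1 = k → P (W i))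
    True (fun _ c => P c) {q | q} (fun W => by simp)
    (fun k W => by
      have : ∀ j : Fin k, (j : ℕ) ≠ k := fun j => j.2.ne
      simp [Fin.forall_fin_succ', this])
    (fun k W => Iff.rfl)⟩

/-- A condition on consecutive letters. The automaton remembers the last letter, which is why the
alphabet has to be finite. -/
theorem Recognizable.succ [Finite X] (R : X → X → Prop) :
    Recognizable fun k (W : Fin k → X) => ∀ i j : Fin k, (i : ℕ) + 1 = j → R (W i) (W j) :=
  ⟨_, RecognizedBy.of_state
    (fun k W => ({c | ∃ i : Fin k, (i : ℕ) + 1 = k ∧ c = W i},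
      (∀ i j : Fin k, (i : ℕ) + 1 = j → R (W i) (W j) : Prop)))
    ((∅ : Set X), True) (fun q c => ({c}, q.2 ∧ ∀ d ∈ q.1, R d c)) {q | q.2}
    (fun W => by simp)
    (fun k W => by
      have h1 : ∀ j : Fin k, (j : ℕ) ≠ k := fun j => j.2.ne
      have h2 : ∀ j : Fin k, k + 1 ≠ (j : ℕ) := fun j => by omega
      ext c
      · simp [Fin.exists_fin_succ', h1]
      · simp [Fin.forall_fin_succ', Fin.init, h2]
        grind)
    (fun k W => Iff.rfl)⟩

end Recognizability

/-! ### A logic with string-valued variables -/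

section CodedFormulas

variable {G Λ : Type*} {a : ℕ}

/-- An interpretation of the atomic formulas of a logic whose variables range over the strings over
`Λ` that have the same length as a given string over `G`. The `t`-th atom is a predicate on the
given string together with `a` strings over `Λ`, which are superposed letter by letter.
Atom `0` is meant to be `⊥`, atom `1` the domain of the first-order quantifiers, atom `2`
membership, atom `3` equality, and atom `r + 4` the relation symbol with number `r`. -/
abbrev Interp (G Λ : Type*) (a : ℕ) :=
  ℕ → (k : ℕ) → (Fin k → G × (Fin a → Λ)) → Prop

/-- The number of the atom at the root of the atomic formula with Gödel number `c`; the value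
is the atom `0` for `⊥` and, as a junk value, for all other numbers. -/
def leafAtom (c : ℕ) : ℕ :=
  if c.unpair.1 = 1 then 3
  else if c.unpair.1 = 2 then c.unpair.2.unpair.1 + 4
  else if c.unpair.1 = 5 then 2
  else 0

/-- The list of variables encoded in the atomic formula for a relation symbol with
Gödel number `c`. -/
def leafVars (c : ℕ) : List ℕ :=
  (Encodable.decode (α := List ℕ) c.unpair.2.unpair.2).getD []

/-- The arguments of the atomic formula with Gödel number `c` if the first-order variables have
the values `e` and the set variables have the values `E`. -/
def leafArgs {V : Type*} (c : ℕ) (e E : ℕ → V) : List V :=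
  if c.unpair.1 = 2 then (leafVars c).map e
  else [e c.unpair.2.unpair.1, if c.unpair.1 = 5 then E c.unpair.2.unpair.2 else
    e c.unpair.2.unpair.2]

theorem leafArgs_map {V V' : Type*} (f : V → V') (c : ℕ) (e E : ℕ → V) :
    (leafArgs c e E).map f = leafArgs c (fun i => f (e i)) (fun i => f (E i)) := by
  unfold leafArgs
  split_ifs <;> simp

/-- The atom `t` holds of the strings in the list `l`; missing arguments are filled up with the
default letter. -/
def Interp.Holds [Inhabited Λ] (ρ : Interp G Λ a) (t : ℕ) {k : ℕ} (S : Fin k → G)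
    (l : List (Fin k → Λ)) : Prop :=
  ρ t k fun j => (S j, fun i => (l.map fun V => V j).getD i default)

theorem unpair_snd_lt {c : ℕ} (h : c.unpair.1 ≠ 0) : c.unpair.2 < c := by
  rcases Nat.lt_or_ge c.unpair.2 c with h' | h'
  · exact h'
  · have h2 := Nat.unpair_add_le c
    omega

theorem unpair_snd_unpair_fst_lt {c : ℕ} (h : c.unpair.1 ≠ 0) : c.unpair.2.unpair.1 < c :=
  (Nat.unpair_left_le _).trans_lt (unpair_snd_lt h)

theorem unpair_snd_unpair_snd_lt {c : ℕ} (h : c.unpair.1 ≠ 0) : c.unpair.2.unpair.2 < c :=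
  (Nat.unpair_right_le _).trans_lt (unpair_snd_lt h)

/-- Satisfaction of the formula with Gödel number `c`, which has `n` free first-order variables and
`m` free set variables, in the string `S`. First-order quantifiers range over the strings that
satisfy atom `1`, set quantifiers over all strings. Being defined on Gödel numbers, it applies to
first-order and to monadic second-order formulas alike. -/
def Interp.Sat [Inhabited Λ] (ρ : Interp G Λ a) {k : ℕ} (S : Fin k → G) (c n m : ℕ)
    (e E : ℕ → Fin k → Λ) : Prop :=
  if h3 : c.unpair.1 = 3 then
    ρ.Sat S c.unpair.2.unpair.1 n m e E → ρ.Sat S c.unpair.2.unpair.2 n m e E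
  else if h4 : c.unpair.1 = 4 then
    ∀ V : Fin k → Λ, ρ.Holds 1 S [V] →
      ρ.Sat S c.unpair.2 (n + 1) m (Function.update e n V) E
  else if h6 : c.unpair.1 = 6 then
    ∀ V : Fin k → Λ, ρ.Sat S c.unpair.2 n (m + 1) e (Function.update E m V)
  else ρ.Holds (leafAtom c) S (leafArgs c e E)
termination_by c
decreasing_by
  · exact unpair_snd_unpair_fst_lt (by omega)
  · exact unpair_snd_unpair_snd_lt (by omega)
  · exact unpair_snd_lt (by omega)
  · exact unpair_snd_lt (by omega)

/-- A bound on the number of states of an automaton for the formula with Gödel number `c`, if `N`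
states are enough for each atom. One step covers every connective: an implication multiplies the
numbers of states of two subformulas, and a quantifier, relativized by an atom, leads to the subset
construction on a product with that atom. -/
def stateBound (N : ℕ) : ℕ → ℕ
  | 0 => N
  | c + 1 => 2 ^ (N * (stateBound N c * stateBound N c))

theorem stateBound_pos {N : ℕ} (hN : 0 < N) (c : ℕ) : 0 < stateBound N c := by
  cases c with
  | zero => exact hN
  | succ c => exact Nat.two_pow_pos _

theorem le_stateBound_succ (N c : ℕ) :
    N * (stateBound N c * stateBound N c) ≤ stateBound N (c + 1) :=
  Nat.lt_two_pow_self.le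

theorem stateBound_mono {N : ℕ} (hN : 0 < N) : Monotone (stateBound N) :=
  monotone_nat_of_le_succ fun c =>
    (Nat.le_mul_of_pos_left _ (stateBound_pos hN c)).trans
      ((Nat.le_mul_of_pos_left _ hN).trans (le_stateBound_succ N c))

/-- The relation defined by a formula is recognized by an automaton whose number of states is
bounded in terms of the Gödel number of the formula. The automaton reads the string and the values
of all variables at once, so its alphabet is infinite. -/
theorem Interp.recognizedBy_sat [Inhabited Λ] (ρ : Interp G Λ a) {N : ℕ} (hN : 0 < N)
    (hρ : ∀ t, RecognizedBy N (ρ t)) (c n m : ℕ) :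
    RecognizedBy (stateBound N c) fun k (W : Fin k → G × (ℕ → Λ) × (ℕ → Λ)) =>
      ρ.Sat (fun j => (W j).1) c n m (fun i j => (W j).2.1 i) (fun i j => (W j).2.2 i) := by
  induction c using Nat.strong_induction_on generalizing n m with
  | _ c ih =>
  have hpos := stateBound_pos hN
  -- Every automaton of the size of an instance of the induction hypothesis for some `d < c`
  -- satisfies the bound for `c`, even after taking products and projecting.
  have key : ∀ d d', d < c → d' < c →
      2 ^ (N * (stateBound N d * stateBound N d')) ≤ stateBound N c := by
    intro d d' hd hd'
    obtain ⟨b, rfl⟩ : ∃ b, c = b + 1 := ⟨c - 1, by omega⟩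
    exact Nat.pow_le_pow_right two_pos (Nat.mul_le_mul_left _ (Nat.mul_le_mul
      (stateBound_mono hN (by omega)) (stateBound_mono hN (by omega))))
  by_cases h3 : c.unpair.1 = 3
  · have hl := unpair_snd_unpair_fst_lt (c := c) (by omega)
    have hr := unpair_snd_unpair_snd_lt (c := c) (by omega)
    refine (((ih _ hl n m).imp (ih _ hr n m)).mono ?_).congr ?_
    · exact ((Nat.le_mul_of_pos_left _ hN).trans Nat.lt_two_pow_self.le).trans (key _ _ hl hr)
    · intro k W
      rw [Interp.Sat, dif_pos h3]
  by_cases h4 : c.unpair.1 = 4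
  · have hl := unpair_snd_lt (c := c) (by omega)
    have h := ((hρ 1).comap fun z : (G × (ℕ → Λ) × (ℕ → Λ)) × Λ =>
        (z.1.1, fun i : Fin a => [z.2].getD i default)).imp
      ((ih _ hl (n + 1) m).comap fun z : (G × (ℕ → Λ) × (ℕ → Λ)) × Λ =>
        (z.1.1, Function.update z.1.2.1 n z.2, z.1.2.2))
    refine (h.forall.mono ?_).congr ?_
    · exact (Nat.pow_le_pow_right two_pos (Nat.mul_le_mul_left _
        (Nat.le_mul_of_pos_left _ (hpos _)))).trans (key _ _ hl hl)
    · intro k W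
      rw [Interp.Sat, dif_neg h3, dif_pos h4]
      refine forall_congr' fun V => ?_
      have : Function.update (fun i j => (W j).2.1 i) n V =
          fun i j => Function.update (W j).2.1 n (V j) i := by
        funext i j
        by_cases hi : i = n
        · subst hi; simp
        · simp [hi]
      rw [this]
      rfl
  by_cases h6 : c.unpair.1 = 6
  · have hl := unpair_snd_lt (c := c) (by omega)
    have h := (ih _ hl n (m + 1)).comap fun z : (G × (ℕ → Λ) × (ℕ → Λ)) × Λ =>
        (z.1.1, z.1.2.1, Function.update z.1.2.2 m z.2)
    refine (h.forall.mono ?_).congr ?_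
    · exact (Nat.pow_le_pow_right two_pos ((Nat.le_mul_of_pos_left _ (hpos _)).trans
        (Nat.le_mul_of_pos_left _ hN))).trans (key _ _ hl hl)
    · intro k W
      rw [Interp.Sat, dif_neg h3, dif_neg h4, dif_pos h6]
      refine forall_congr' fun V => ?_
      have : Function.update (fun i j => (W j).2.2 i) m V =
          fun i j => Function.update (W j).2.2 m (V j) i := by
        funext i j
        by_cases hi : i = m
        · subst hi; simp
        · simp [hi]
      rw [this]
  · refine (((hρ (leafAtom c)).comap fun z : G × (ℕ → Λ) × (ℕ → Λ) =>
      (z.1, fun i : Fin a => (leafArgs c z.2.1 z.2.2).getD i default)).mono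
        (stateBound_mono hN (Nat.zero_le c))).congr ?_
    intro k W
    rw [Interp.Sat, dif_neg h3, dif_neg h4, dif_neg h6, Interp.Holds]
    simp only [leafArgs_map]

/-- The set of strings that satisfy a sentence is recognized by an automaton whose number of states
is bounded in terms of the Gödel number of the sentence. -/
theorem Interp.recognizedBy_sat_sentence [Inhabited Λ] (ρ : Interp G Λ a) {N : ℕ} (hN : 0 < N)
    (hρ : ∀ t, RecognizedBy N (ρ t)) (c : ℕ) :
    RecognizedBy (stateBound N c) fun k (S : Fin k → G) =>
      ρ.Sat S c 0 0 default default :=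
  (ρ.recognizedBy_sat hN hρ c 0 0).comap fun s => (s, default, default)

/-- If only finitely many atoms are satisfiable, one number of states is enough for all atoms. -/
theorem Interp.exists_recognizedBy (ρ : Interp G Λ a) (hρ : ∀ t, Recognizable (ρ t))
    {R : ℕ} (hR : ∀ t, R ≤ t → ∀ k W, ¬ ρ t k W) :
    ∃ N, 0 < N ∧ ∀ t, RecognizedBy N (ρ t) := by
  choose N hN using hρ
  refine ⟨(Finset.range R).sup N + 1, Nat.succ_pos _, fun t => ?_⟩
  rcases lt_or_ge t R with h | h
  · exact (hN t).mono ((Finset.le_sup (f := N) (Finset.mem_range.2 h)).trans (Nat.le_succ _))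
  · refine (RecognizedBy.false.mono (Nat.le_add_left _ _)).congr fun k W => ?_
    simp [hR t h k W]

theorem Interp.sat_falsum [Inhabited Λ] {ρ : Interp G Λ a} {k : ℕ} {S : Fin k → G} {n m : ℕ}
    {e E : ℕ → Fin k → Λ} :
    ρ.Sat S (Nat.pair 0 0) n m e E ↔ ρ.Holds 0 S [e 0, e 0] := by
  rw [Interp.Sat]
  simp [leafAtom, leafArgs]

theorem Interp.sat_equal [Inhabited Λ] {ρ : Interp G Λ a} {k : ℕ} {S : Fin k → G} {n m : ℕ}
    {e E : ℕ → Fin k → Λ} {x y : ℕ} :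
    ρ.Sat S (Nat.pair 1 (Nat.pair x y)) n m e E ↔ ρ.Holds 3 S [e x, e y] := by
  rw [Interp.Sat]
  simp [leafAtom, leafArgs]

theorem Interp.sat_rel [Inhabited Λ] {ρ : Interp G Λ a} {k : ℕ} {S : Fin k → G} {n m : ℕ}
    {e E : ℕ → Fin k → Λ} {r : ℕ} {xs : List ℕ} :
    ρ.Sat S (Nat.pair 2 (Nat.pair r (Encodable.encode xs))) n m e E ↔
      ρ.Holds (r + 4) S (xs.map e) := by
  rw [Interp.Sat]
  simp [leafAtom, leafArgs, leafVars]

theorem Interp.sat_imp [Inhabited Λ] {ρ : Interp G Λ a} {k : ℕ} {S : Fin k → G} {n m : ℕ}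
    {e E : ℕ → Fin k → Λ} {c d : ℕ} :
    ρ.Sat S (Nat.pair 3 (Nat.pair c d)) n m e E ↔ (ρ.Sat S c n m e E → ρ.Sat S d n m e E) := by
  rw [Interp.Sat]
  simp

theorem Interp.sat_all [Inhabited Λ] {ρ : Interp G Λ a} {k : ℕ} {S : Fin k → G} {n m : ℕ}
    {e E : ℕ → Fin k → Λ} {c : ℕ} :
    ρ.Sat S (Nat.pair 4 c) n m e E ↔ ∀ V : Fin k → Λ, ρ.Holds 1 S [V] →
      ρ.Sat S c (n + 1) m (Function.update e n V) E := by
  rw [Interp.Sat]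
  simp

theorem Interp.sat_mem [Inhabited Λ] {ρ : Interp G Λ a} {k : ℕ} {S : Fin k → G} {n m : ℕ}
    {e E : ℕ → Fin k → Λ} {x y : ℕ} :
    ρ.Sat S (Nat.pair 5 (Nat.pair x y)) n m e E ↔ ρ.Holds 2 S [e x, E y] := by
  rw [Interp.Sat]
  simp [leafAtom, leafArgs]

theorem Interp.sat_allSet [Inhabited Λ] {ρ : Interp G Λ a} {k : ℕ} {S : Fin k → G} {n m : ℕ}
    {e E : ℕ → Fin k → Λ} {c : ℕ} :
    ρ.Sat S (Nat.pair 6 c) n m e E ↔ ∀ V : Fin k → Λ,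
      ρ.Sat S c n (m + 1) e (Function.update E m V) := by
  rw [Interp.Sat]
  simp

end CodedFormulas

/-! ### Primitive recursive evaluation -/

section Evaluation

/-- The string of length `k` over `{0, …, b - 1}` whose letters are the `k` lowest digits of `n` in
base `b`. -/
def digitString (b : ℕ) [NeZero b] (k n : ℕ) : Fin k → Fin b :=
  fun j => Fin.ofNat b (n / b ^ (j : ℕ))

theorem exists_digitString_eq {b k : ℕ} [NeZero b] (V : Fin k → Fin b) :
    ∃ n < b ^ k, digitString b k n = V := by
  refine ⟨finFunctionFinEquiv V, (finFunctionFinEquiv V).2, ?_⟩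
  funext j
  refine Fin.ext ?_
  have := congrFun (finFunctionFinEquiv.symm_apply_apply V) j
  rw [← this, finFunctionFinEquiv_symm_apply_val]
  simp [digitString]

theorem forall_digitString {b k : ℕ} [NeZero b] {P : (Fin k → Fin b) → Prop} :
    (∀ V, P V) ↔ ∀ n < b ^ k, P (digitString b k n) := by
  refine ⟨fun h n _ => h _, fun h V => ?_⟩
  obtain ⟨n, hn, rfl⟩ := exists_digitString_eq V
  exact h n hn

theorem Primrec.nat_pow : Primrec₂ ((· ^ ·) : ℕ → ℕ → ℕ) :=
  Primrec₂.unpaired'.1 Nat.Primrec.pow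

theorem Primrec.fin_ofNat (b : ℕ) [NeZero b] : Primrec (Fin.ofNat b) :=
  Primrec.fin_val_iff.1 (Primrec.nat_mod.comp .id (.const b))

theorem primrec_digit (b : ℕ) [NeZero b] : Primrec₂ fun n j : ℕ => Fin.ofNat b (n / b ^ j) :=
  (Primrec.fin_ofNat b).comp
    (Primrec.nat_div.comp .fst (Primrec.nat_pow.comp (.const b) .snd))

variable {g b a : ℕ} [NeZero g] [NeZero b]

/-- Membership in a fixed recognizable predicate is primitive recursive: run the automaton. -/
theorem Recognizable.primrecPred {Q : (k : ℕ) → (Fin k → Fin g × (Fin a → Fin b)) → Prop}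
    (hQ : Recognizable Q) : PrimrecPred fun z : (ℕ × ℕ) × List ℕ =>
      Q z.1.1 fun j => (digitString g z.1.1 z.1.2 j,
        fun i => ((z.2.map (digitString b z.1.1)).map fun V => V j).getD i default) := by
  obtain ⟨N, σ, _, M', -, hM⟩ := hQ
  obtain ⟨q, M, hMM⟩ : ∃ q, ∃ M : DFA (Fin g × (Fin a → Fin b)) (Fin q),
      M.accepts = M'.accepts :=
    ⟨_, DFA.reindex (Fintype.equivFin σ) M', DFA.accepts_reindex _ _⟩
  let letter (z : (ℕ × ℕ) × List ℕ) (j : ℕ) : Fin g × (Fin a → Fin b) :=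
    (Fin.ofNat g (z.1.2 / g ^ j), fun i => Fin.ofNat b (z.2.getD i 0 / b ^ j))
  have hletter : Primrec₂ letter := by
    refine Primrec.pair ((primrec_digit g).comp (Primrec.snd.comp (Primrec.fst.comp .fst)) .snd) ?_
    have h : Primrec₂ fun (i : Fin a) (y : ((ℕ × ℕ) × List ℕ) × ℕ) =>
        Fin.ofNat b (y.1.2.getD i 0 / b ^ y.2) := Primrec.fin_curry₁.2 fun i =>
      (primrec_digit b).comp ((Primrec.list_getD 0).comp
        (Primrec.snd.comp Primrec.fst) (.const _)) .snd
    exact Primrec.fin_curry.2 h.swap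
  let run (z : (ℕ × ℕ) × List ℕ) : Fin q :=
    Nat.rec M.start (fun j s => M.step s (letter z j)) z.1.1
  have hrun : Primrec run := by
    refine Primrec.nat_rec' (f := fun z : (ℕ × ℕ) × List ℕ => z.1.1)
      (h := fun z js => M.step js.2 (letter z js.1))
      (Primrec.fst.comp Primrec.fst) (Primrec.const M.start) ?_
    exact (Primrec.dom_finite
      (fun y : Fin q × Fin g × (Fin a → Fin b) => M.step y.1 y.2)).comp
        (Primrec.pair (Primrec.snd.comp Primrec.snd)
          (hletter.comp Primrec.fst (Primrec.fst.comp Primrec.snd)))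
  have hacc : PrimrecPred fun z => run z ∈ M.accept := by
    classical
    exact Primrec.primrecPred
      ((Primrec.dom_finite fun s : Fin q => decide (s ∈ M.accept)).comp hrun)
  refine hacc.of_eq fun z => ?_
  obtain ⟨⟨k, s⟩, l⟩ := z
  rw [hM, ← hMM, DFA.mem_accepts]
  have : ∀ p, M.eval (List.ofFn fun j : Fin p => letter ((k, s), l) j) =
      Nat.rec M.start (fun j t => M.step t (letter ((k, s), l) j)) p := by
    intro p
    induction p with
    | zero => simp
    | succ p ih =>
      rw [List.ofFn_succ', List.concat_eq_append, DFA.eval_append_singleton]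
      exact congrArg (fun t => M.step t (letter ((k, s), l) p)) ih
  have hl : (fun j : Fin k => letter ((k, s), l) j) = fun j : Fin k => (digitString g k s j,
      fun i : Fin a => ((l.map (digitString b k)).map fun V => V j).getD i default) := by
    funext j
    refine Prod.ext rfl ?_
    funext i
    simp only [letter, List.getD_eq_getElem?_getD, List.getElem?_map]
    cases l[(i : ℕ)]? <;> simp [digitString, Fin.default_eq_zero]
  rw [← hl, this k]

/-- A sequence of primitive recursive predicates that is eventually empty is primitive recursive
jointly with its index. -/
theorem PrimrecPred.of_forall_index {α : Type*} [Primcodable α] {p : ℕ → α → Prop} (R : ℕ)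
    (hp : ∀ t, PrimrecPred (p t)) (hR : ∀ t, R ≤ t → ∀ x, ¬ p t x) :
    PrimrecPred fun y : ℕ × α => p y.1 y.2 := by
  have h : ∀ r, PrimrecPred fun y : ℕ × α => y.1 < r ∧ p y.1 y.2 := by
    intro r
    induction r with
    | zero =>
      exact PrimrecPred.of_eq (Primrec.nat_lt.comp .fst (.const 0)) fun y => by simp
    | succ r ih =>
      refine (ih.or ((Primrec.eq.comp .fst (.const r)).and
        ((hp r).comp Primrec.snd))).of_eq fun y => ?_
      rw [Nat.lt_succ_iff_lt_or_eq]
      constructor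
      · rintro (h | ⟨rfl, h⟩)
        · exact ⟨.inl h.1, h.2⟩
        · exact ⟨.inr rfl, h⟩
      · rintro ⟨h | rfl, h'⟩
        · exact .inl ⟨h, h'⟩
        · exact .inr ⟨rfl, h'⟩
  refine (h R).of_eq fun y => ⟨fun h => h.2, fun h => ⟨?_, h⟩⟩
  by_contra hy
  exact hR _ (not_lt.1 hy) _ h

/-- A family of recognizable atoms, only finitely many of them satisfiable, can be evaluated
primitive recursively. -/
theorem Interp.primrecPred_holds (ρ : Interp (Fin g) (Fin b) a) (hρ : ∀ t, Recognizable (ρ t))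
    {R : ℕ} (hR : ∀ t, R ≤ t → ∀ k W, ¬ ρ t k W) :
    PrimrecPred fun y : ℕ × (ℕ × ℕ) × List ℕ =>
      ρ.Holds y.1 (digitString g y.2.1.1 y.2.1.2) (y.2.2.map (digitString b y.2.1.1)) :=
  PrimrecPred.of_forall_index (p := fun t (z : (ℕ × ℕ) × List ℕ) =>
    ρ.Holds t (digitString g z.1.1 z.1.2) (z.2.map (digitString b z.1.1))) R
    (fun t => (hρ t).primrecPred) (fun t ht _ => hR t ht _ _)

theorem primrec_leafAtom : Primrec leafAtom := by
  have ht : Primrec fun c : ℕ => c.unpair.1 := Primrec.fst.comp Primrec.unpair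
  refine Primrec.ite (Primrec.eq.comp ht (.const 1)) (.const 3)
    (Primrec.ite (Primrec.eq.comp ht (.const 2)) ?_
      (Primrec.ite (Primrec.eq.comp ht (.const 5)) (.const 2) (.const 0)))
  exact Primrec.nat_add.comp (Primrec.fst.comp (Primrec.unpair.comp
    (Primrec.snd.comp Primrec.unpair))) (.const 4)

theorem primrec_leafArgs : Primrec fun y : ℕ × List ℕ × List ℕ =>
    leafArgs y.1 (fun i => y.2.1.getD i 0) (fun i => y.2.2.getD i 0) := by
  have ht : Primrec fun y : ℕ × List ℕ × List ℕ => y.1.unpair.1 :=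
    Primrec.fst.comp (Primrec.unpair.comp .fst)
  have hd : Primrec fun y : ℕ × List ℕ × List ℕ => y.1.unpair.2.unpair :=
    Primrec.unpair.comp (Primrec.snd.comp (Primrec.unpair.comp .fst))
  have hg := Primrec.list_getD (0 : ℕ)
  have he : Primrec fun y : ℕ × List ℕ × List ℕ => y.2.1 := Primrec.fst.comp .snd
  have hE : Primrec fun y : ℕ × List ℕ × List ℕ => y.2.2 := Primrec.snd.comp .snd
  refine Primrec.ite (Primrec.eq.comp ht (.const 2)) ?_ ?_
  · refine Primrec.list_map (f := fun y : ℕ × List ℕ × List ℕ => leafVars y.1) ?_ ?_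
    · exact Primrec.option_getD.comp (Primrec.decode.comp (Primrec.snd.comp hd)) (.const [])
    · exact hg.comp (he.comp .fst) .snd
  · refine Primrec.list_cons.comp (hg.comp he (Primrec.fst.comp hd))
      (Primrec.list_cons.comp ?_ (.const []))
    exact Primrec.ite (Primrec.eq.comp ht (.const 5)) (hg.comp hE (Primrec.snd.comp hd))
      (hg.comp he (Primrec.snd.comp hd))


/-- Satisfaction of a formula is a primitive recursive function of the Gödel number of the formula
and of the numbers that represent the string and the values of the variables. -/
theorem Interp.primrecPred_sat (ρ : Interp (Fin g) (Fin b) a) (hρ : ∀ t, Recognizable (ρ t))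
    {R : ℕ} (hR : ∀ t, R ≤ t → ∀ k W, ¬ ρ t k W) :
    PrimrecPred fun y : ℕ × (ℕ × ℕ) × List ℕ × List ℕ =>
      ρ.Sat (digitString g y.2.1.1 y.2.1.2) y.1 y.2.2.1.length y.2.2.2.length
        (fun i => digitString b y.2.1.1 (y.2.2.1.getD i 0))
        (fun i => digitString b y.2.1.1 (y.2.2.2.getD i 0)) := by
  classical
  -- Recursion on the Gödel number, while the values of the variables change: `sub` lists the
  -- instances of the immediate subformulas, and `comb` combines their truth values.
  let α := ℕ × (ℕ × ℕ) × List ℕ × List ℕ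
  let T (y : α) : Prop := ρ.Sat (digitString g y.2.1.1 y.2.1.2) y.1 y.2.2.1.length y.2.2.2.length
        (fun i => digitString b y.2.1.1 (y.2.2.1.getD i 0))
        (fun i => digitString b y.2.1.1 (y.2.2.2.getD i 0))
  let sub (y : α) : List α :=
    if y.1.unpair.1 = 3 then
      [(y.1.unpair.2.unpair.1, y.2), (y.1.unpair.2.unpair.2, y.2)]
    else if y.1.unpair.1 = 4 then
      (List.range (b ^ y.2.1.1)).map fun i => (y.1.unpair.2, y.2.1, y.2.2.1 ++ [i], y.2.2.2)
    else if y.1.unpair.1 = 6 then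
      (List.range (b ^ y.2.1.1)).map fun i => (y.1.unpair.2, y.2.1, y.2.2.1, y.2.2.2 ++ [i])
    else []
  let H (t : ℕ) (z : ℕ × ℕ) (l : List ℕ) : Prop :=
    ρ.Holds t (digitString g z.1 z.2) (l.map (digitString b z.1))
  let comb (y : α) (l : List Bool) : Bool :=
    if y.1.unpair.1 = 3 then decide (¬ l.getD 0 false = true ∨ l.getD 1 false = true)
    else if y.1.unpair.1 = 4 then
      decide (∀ i ∈ List.range (b ^ y.2.1.1), ¬ H 1 y.2.1 [i] ∨ l.getD i false = true)
    else if y.1.unpair.1 = 6 then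
      decide (∀ i ∈ List.range (b ^ y.2.1.1), l.getD i false = true)
    else decide (H (leafAtom y.1) y.2.1
      (leafArgs y.1 (fun i => y.2.2.1.getD i 0) (fun i => y.2.2.2.getD i 0)))
  have hu : Primrec fun y : α => y.1.unpair := Primrec.unpair.comp .fst
  have ht : ∀ r, PrimrecPred fun y : α => y.1.unpair.1 = r := fun r =>
    Primrec.eq.comp (Primrec.fst.comp hu) (.const r)
  have hk : Primrec fun y : α => List.range (b ^ y.2.1.1) :=
    Primrec.list_range.comp (Primrec.nat_pow.comp (.const b)
      (Primrec.fst.comp (Primrec.fst.comp .snd)))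
  have hz : Primrec fun y : α => y.2.1 := Primrec.fst.comp .snd
  have he : Primrec fun y : α => y.2.2.1 := Primrec.fst.comp (Primrec.snd.comp .snd)
  have hE : Primrec fun y : α => y.2.2.2 := Primrec.snd.comp (Primrec.snd.comp .snd)
  have hd : Primrec fun y : α => y.1.unpair.2 := Primrec.snd.comp hu
  have hH := ρ.primrecPred_holds hρ hR
  have hsub : Primrec sub := by
    refine Primrec.ite (ht 3) ?_ (Primrec.ite (ht 4) ?_ (Primrec.ite (ht 6) ?_ (.const [])))
    · exact Primrec.list_cons.comp (.pair (Primrec.fst.comp (Primrec.unpair.comp hd)) .snd)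
        (Primrec.list_cons.comp (.pair (Primrec.snd.comp (Primrec.unpair.comp hd)) .snd)
          (.const []))
    · exact Primrec.list_map hk (Primrec.pair (hd.comp .fst) (.pair (hz.comp .fst)
        (.pair (Primrec.list_concat.comp (he.comp .fst) .snd) (hE.comp .fst))))
    · exact Primrec.list_map hk (Primrec.pair (hd.comp .fst) (.pair (hz.comp .fst)
        (.pair (he.comp .fst) (Primrec.list_concat.comp (hE.comp .fst) .snd))))
  have hget : ∀ {β : Type} [Primcodable β] {f : β → List Bool} {i : β → ℕ}, Primrec f →
      Primrec i → PrimrecPred fun x => (f x).getD (i x) false = true := fun hf hi =>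
    Primrec.eq.comp ((Primrec.list_getD false).comp hf hi) (.const true)
  have hcomb : Primrec₂ comb := by
    have hall : ∀ {R : ℕ → α × List Bool → Prop}, PrimrecRel R →
        PrimrecPred fun p : α × List Bool => ∀ i ∈ List.range (b ^ p.1.2.1.1), R i p := fun hR =>
      hR.forall_mem_list.comp (hk.comp Primrec.fst) Primrec.id
    refine Primrec.ite ((ht 3).comp .fst) ?_ (Primrec.ite ((ht 4).comp .fst) ?_
      (Primrec.ite ((ht 6).comp .fst) ?_ ?_))
    · exact ((hget .snd (.const 0)).not.or (hget .snd (.const 1))).decide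
    · refine (hall (R := fun i p => ¬ H 1 p.1.2.1 [i] ∨ p.2.getD i false = true) ?_).decide
      refine PrimrecPred.or (PrimrecPred.not ?_) (hget (Primrec.snd.comp .snd) .fst)
      exact hH.comp (.pair (.const 1) (.pair (hz.comp (Primrec.fst.comp .snd))
        (Primrec.list_cons.comp .fst (.const []))))
    · exact (hall (R := fun i p => p.2.getD i false = true)
        (hget (Primrec.snd.comp .snd) .fst)).decide
    · refine PrimrecPred.decide (p := fun p : α × List Bool => H (leafAtom p.1.1) p.1.2.1
        (leafArgs p.1.1 (fun i => p.1.2.2.1.getD i 0) (fun i => p.1.2.2.2.getD i 0))) ?_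
      exact hH.comp (.pair (primrec_leafAtom.comp (Primrec.fst.comp .fst))
        (.pair (hz.comp .fst) (primrec_leafArgs.comp
          (.pair (Primrec.fst.comp .fst) (Primrec.snd.comp (Primrec.snd.comp .fst))))))
  -- A quantifier binds the variable whose index is the number of variables bound so far.
  have hupd : ∀ (k i : ℕ) (l : List ℕ),
      Function.update (fun j => digitString b k (l.getD j 0)) l.length (digitString b k i) =
        fun j => digitString b k ((l ++ [i]).getD j 0) := by
    intro k i l
    funext j
    rcases lt_trichotomy j l.length with h | rfl | h
    · simp [h.ne, List.getElem?_append_left h]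
    · simp
    · have h1 : l.length ≤ j := h.le
      have h2 : (l ++ [i]).length ≤ j := by simpa using h
      rw [Function.update_of_ne h.ne', List.getD_eq_default _ _ h1, List.getD_eq_default _ _ h2]
  refine Primrec.primrecPred (Primrec.nat_omega_rec' (fun y => decide (T y)) (m := fun y => y.1)
    (l := sub) (g := fun y l => some (comb y l)) .fst hsub (Primrec.option_some.comp hcomb) ?_ ?_)
  · rintro ⟨c, z, e, E⟩ y hy
    simp only [sub] at hy
    split_ifs at hy with h3 h4 h6
    · have := unpair_snd_unpair_fst_lt (c := c) (by omega)
      have := unpair_snd_unpair_snd_lt (c := c) (by omega)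
      simp only [List.mem_cons, List.not_mem_nil, or_false] at hy
      rcases hy with rfl | rfl <;> assumption
    · obtain ⟨i, -, rfl⟩ := List.mem_map.1 hy
      exact unpair_snd_lt (by omega)
    · obtain ⟨i, -, rfl⟩ := List.mem_map.1 hy
      exact unpair_snd_lt (by omega)
    · simp at hy
  · rintro ⟨c, ⟨k, s⟩, e, E⟩
    have hrange : ∀ (f : ℕ → Prop) (i : ℕ), i < b ^ k →
        (((List.range (b ^ k)).map fun i => decide (f i)).getD i false = true ↔ f i) := by
      intro f i hi
      simp [hi]
    refine congrArg some ?_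
    rw [Bool.eq_iff_iff, decide_eq_true_iff]
    simp only [T, comb, sub]
    conv_rhs => rw [Interp.Sat]
    split_ifs with h3 h4 h6
    · simp [imp_iff_not_or]
    · rw [forall_digitString]
      simp only [List.map_map, decide_eq_true_iff, List.mem_range]
      refine forall₂_congr fun i hi => ?_
      rw [imp_iff_not_or, hupd]
      refine or_congr Iff.rfl ((hrange _ i hi).trans ?_)
      simp
    · rw [forall_digitString]
      simp only [List.map_map, decide_eq_true_iff, List.mem_range]
      refine forall₂_congr fun i hi => ?_
      rw [hupd]
      refine (hrange _ i hi).trans ?_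
      simp
    · simp only [decide_eq_true_iff, H, leafArgs_map]


theorem primrec_stateBound (N : ℕ) : Primrec (stateBound N) := by
  refine (Primrec.nat_rec₁ (f := fun _ r => 2 ^ (N * (r * r))) N ?_).of_eq fun c => ?_
  · exact Primrec.nat_pow.comp (.const 2) (Primrec.nat_mul.comp (.const N)
      (Primrec.nat_mul.comp .snd .snd))
  · induction c with
    | zero => rfl
    | succ c ih => rw [stateBound, ← ih]

/-- It is decidable whether some string in a recognizable set satisfies two given sentences. By
pumping, it suffices to examine the strings up to a length that is bounded in terms of the Gödel
numbers of the sentences. -/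
theorem Interp.primrecPred_exists_sat {b' a' : ℕ} [NeZero b'] {Q : (k : ℕ) → (Fin k → Fin g) → Prop}
    (hQ : Recognizable Q) (ρ : Interp (Fin g) (Fin b) a) (hρ : ∀ t, Recognizable (ρ t))
    {R : ℕ} (hR : ∀ t, R ≤ t → ∀ k W, ¬ ρ t k W)
    (ρ' : Interp (Fin g) (Fin b') a') (hρ' : ∀ t, Recognizable (ρ' t))
    {R' : ℕ} (hR' : ∀ t, R' ≤ t → ∀ k W, ¬ ρ' t k W) :
    PrimrecPred fun c : ℕ × ℕ => ∃ (k : ℕ) (S : Fin k → Fin g),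
      Q k S ∧ ρ.Sat S c.1 0 0 default default ∧ ρ'.Sat S c.2 0 0 default default := by
  obtain ⟨N, hN, hNρ⟩ := ρ.exists_recognizedBy hρ hR
  obtain ⟨N', hN', hNρ'⟩ := ρ'.exists_recognizedBy hρ' hR'
  obtain ⟨M, hM⟩ := hQ
  let B (c : ℕ × ℕ) : ℕ := M * (stateBound N c.1 * stateBound N' c.2)
  have hB : Primrec B := Primrec.nat_mul.comp (.const M) (Primrec.nat_mul.comp
    ((primrec_stateBound N).comp .fst) ((primrec_stateBound N').comp .snd))
  let D (c : ℕ × ℕ) (z : ℕ × ℕ) : Prop := Q z.1 (digitString g z.1 z.2) ∧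
    ρ.Sat (digitString g z.1 z.2) c.1 0 0 default default ∧
    ρ'.Sat (digitString g z.1 z.2) c.2 0 0 default default
  have hQ' : PrimrecPred fun z : ℕ × ℕ => Q z.1 (digitString g z.1 z.2) := by
    have h : Recognizable fun k (W : Fin k → Fin g × (Fin 0 → Fin 1)) => Q k fun j => (W j).1 :=
      Recognizable.comap Prod.fst ⟨M, hM⟩
    exact h.primrecPred.comp (Primrec.pair .id (.const []))
  -- The digits of the junk value `0` are the default letters.
  have hdef : ∀ (b k : ℕ) [NeZero b], (fun i => digitString b k (([] : List ℕ).getD i 0)) =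
      default := by
    intro b k _
    funext i j
    simp [digitString, Fin.default_eq_zero]
  have hsat : ∀ {b a : ℕ} [NeZero b] (ρ : Interp (Fin g) (Fin b) a),
      (∀ t, Recognizable (ρ t)) → ∀ {R}, (∀ t, R ≤ t → ∀ k W, ¬ ρ t k W) →
      PrimrecPred fun y : ℕ × ℕ × ℕ =>
        ρ.Sat (digitString g y.2.1 y.2.2) y.1 0 0 default default := by
    intro b a _ ρ hρ R hR
    refine ((ρ.primrecPred_sat hρ hR).comp (f := fun y : ℕ × ℕ × ℕ => (y.1, y.2, [], []))
      (.pair .fst (.pair .snd (.const _)))).of_eq fun y => ?_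
    simp only [hdef, List.length_nil]
  have hD : PrimrecRel D := (hQ'.comp Primrec.snd).and
    (((hsat ρ hρ hR).comp (.pair (Primrec.fst.comp .fst) .snd)).and
      ((hsat ρ' hρ' hR').comp (.pair (Primrec.snd.comp .fst) .snd)))
  have hex : PrimrecPred fun c : ℕ × ℕ => ∃ k ∈ List.range (B c + 1),
      ∃ n ∈ List.range (g ^ k), D c (k, n) := by
    refine PrimrecRel.comp (R := fun (L : List ℕ) (c : ℕ × ℕ) =>
      ∃ k ∈ L, ∃ n ∈ List.range (g ^ k), D c (k, n))
      (PrimrecRel.exists_mem_list ?_) (Primrec.list_range.comp (Primrec.succ.comp hB)) .id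
    refine PrimrecRel.comp (R := fun (L : List ℕ) (z : ℕ × ℕ × ℕ) =>
      ∃ n ∈ L, D z.2 (z.1, n)) (f := fun z : ℕ × ℕ × ℕ => List.range (g ^ z.1)) (g := id)
      (PrimrecRel.exists_mem_list ?_)
      (Primrec.list_range.comp (Primrec.nat_pow.comp (.const g) .fst)) .id
    exact hD.comp (Primrec.snd.comp .snd) (.pair (Primrec.fst.comp .snd) .fst)
  refine hex.of_eq fun c => ⟨?_, ?_⟩
  · rintro ⟨k, -, n, -, h⟩
    exact ⟨k, _, h⟩
  · rintro ⟨k, S, h⟩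
    obtain ⟨k', hk', S', h'⟩ := (hM.and ((ρ.recognizedBy_sat_sentence hN hNρ c.1).and
      (ρ'.recognizedBy_sat_sentence hN' hNρ' c.2))).exists_le h
    obtain ⟨n, hn, rfl⟩ := exists_digitString_eq S'
    exact ⟨k', by simpa [Nat.lt_succ_iff] using hk', n, by simpa using hn, h'⟩

end Evaluation

/-! ### Recognizability for ordered decision diagrams -/

section DecisionDiagrams

variable {B : Type*} {w : ℕ}

/-- The string `s` padded with `□` to the length `k`. -/
def padStr (k : ℕ) (s : List B) : Fin k → Option B :=
  fun j => s[(j : ℕ)]?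

theorem padStr_injOn {k : ℕ} {s s' : List B} (hs : s.length ≤ k) (hs' : s'.length ≤ k)
    (h : padStr k s = padStr k s') : s = s' := by
  refine List.ext_getElem? fun i => ?_
  rcases lt_or_ge i k with hi | hi
  · exact congrFun h ⟨i, hi⟩
  · rw [List.getElem?_eq_none (hs.trans hi), List.getElem?_eq_none (hs'.trans hi)]

theorem padStr_map {C : Type*} (k : ℕ) (f : B → C) (s : List B) :
    padStr k (s.map f) = fun j => (padStr k s j).map f := by
  funext j
  simp [padStr]

theorem exists_eq_padStr {k : ℕ} {v : Fin k → Option B} :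
    (∃ s : List B, s ≠ [] ∧ s.length ≤ k ∧ v = padStr k s) ↔
      (∃ _ : Fin k, True) ∧ (∀ i : Fin k, (i : ℕ) = 0 → v i ≠ none) ∧
        ∀ i j : Fin k, (i : ℕ) + 1 = j → v i = none → v j = none := by
  constructor
  · rintro ⟨s, hs, hsk, rfl⟩
    have hpos := List.length_pos_iff.2 hs
    refine ⟨⟨⟨0, by omega⟩, trivial⟩, fun i hi => ?_, fun i j hij => ?_⟩
    · simp only [padStr, ne_eq, List.getElem?_eq_none_iff]
      omega
    · simp only [padStr, List.getElem?_eq_none_iff]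
      omega
  · rintro ⟨⟨i₀, -⟩, h0, hs⟩
    -- The unpadded string consists of the letters before the first padding symbol.
    have hex : ∃ p, ∀ h : p < k, v ⟨p, h⟩ = none := ⟨k, fun h => (lt_irrefl _ h).elim⟩
    classical
    obtain ⟨p, hp, hmin⟩ : ∃ p, (∀ h : p < k, v ⟨p, h⟩ = none) ∧
        ∀ q < p, ∃ h : q < k, v ⟨q, h⟩ ≠ none :=
      ⟨Nat.find hex, Nat.find_spec hex, fun q hq => by simpa using Nat.find_min hex hq⟩
    have hafter : ∀ d, ∀ h : p + d < k, v ⟨p + d, h⟩ = none := by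
      intro d
      induction d with
      | zero => exact hp
      | succ d ih => exact fun h => hs ⟨p + d, by omega⟩ ⟨p + (d + 1), h⟩ rfl (ih _)
    choose hk hv using hmin
    refine ⟨List.ofFn fun i : Fin p => (v ⟨i, hk i i.2⟩).get
      (Option.isSome_iff_ne_none.2 (hv i i.2)), ?_, ?_, ?_⟩
    · intro h
      have := congrArg List.length h
      rw [List.length_ofFn, List.length_nil] at this
      subst this
      have hk0 : 0 < k := i₀.pos
      exact h0 ⟨0, hk0⟩ rfl (hp hk0)
    · rw [List.length_ofFn]
      by_contra h
      exact lt_irrefl _ (hk k (by omega))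
    · funext j
      rw [padStr, List.getElem?_ofFn]
      split_ifs with hj
      · simp
      · obtain ⟨d, hd⟩ := Nat.exists_eq_add_of_le (not_lt.1 hj)
        have := hafter d (by omega)
        rw [← this]
        congr 1
        exact Fin.ext hd

/-- The string `v` is a string of the language of the ODD `D`, padded to the length of `D`. -/
def OddAccepts {k : ℕ} (D : Fin k → Layer B w) (v : Fin k → Option B) : Prop :=
  ∃ s ∈ oddLang D, v = padStr k s

theorem oddAccepts_padStr {k : ℕ} {D : Fin k → Layer B w} {s : List B} (hs : s.length ≤ k) :
    OddAccepts D (padStr k s) ↔ s ∈ oddLang D := by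
  refine ⟨?_, fun h => ⟨s, h, rfl⟩⟩
  rintro ⟨s', hs', h⟩
  rwa [padStr_injOn hs hs'.2.1 h]

/-- An accepting run on a padded string is a pair of states at each position, the source and the
target of the transition taken there, subject to local conditions. -/
theorem oddAccepts_iff {k : ℕ} {D : Fin k → Layer B w} {v : Fin k → Option B} :
    OddAccepts D v ↔
      ((∃ _ : Fin k, True) ∧ (∀ i : Fin k, (i : ℕ) = 0 → v i ≠ none) ∧
        ∀ i j : Fin k, (i : ℕ) + 1 = j → v i = none → v j = none) ∧
      ∃ r : Fin k → Fin w × Fin w,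
        (∀ i, ((r i).1, v i, (r i).2) ∈ (D i).trans) ∧
        (∀ i j : Fin k, (i : ℕ) + 1 = j → (r i).2 = (r j).1) ∧
        (∀ i : Fin k, (i : ℕ) = 0 → (r i).1 ∈ (D i).init) ∧
        (∀ i : Fin k, (i : ℕ) + 1 = k → (r i).2 ∈ (D i).final) := by
  rw [← exists_eq_padStr]
  constructor
  · rintro ⟨s, ⟨hs, hsk, r, h1, h2, h3⟩, rfl⟩
    refine ⟨⟨s, hs, hsk, rfl⟩, fun i => (r i.castSucc, r i.succ), h1, fun i j hij => ?_, h2, h3⟩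
    exact congrArg r (Fin.ext hij)
  · rintro ⟨⟨s, hs, hsk, rfl⟩, r, h1, h2, h3, h4⟩
    have hpos := List.length_pos_iff.2 hs
    obtain ⟨k, rfl⟩ : ∃ k', k = k' + 1 := ⟨k - 1, by omega⟩
    let q : Fin (k + 1 + 1) → Fin w := Fin.cons (r 0).1 fun i => (r i).2
    have hq : ∀ i : Fin (k + 1), q i.castSucc = (r i).1 := by
      intro i
      refine Fin.cases rfl (fun i => ?_) i
      exact h2 i.castSucc i.succ (by simp)
    refine ⟨s, ⟨hs, hsk, q, fun i => ?_, fun i hi => ?_, fun i hi => ?_⟩, rfl⟩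
    · rw [hq]
      exact h1 i
    · rw [hq]
      exact h3 i hi
    · exact h4 i hi

theorem recognizable_oddAccepts [Finite B] :
    Recognizable fun k (W : Fin k → Layer B w × Option B) =>
      OddAccepts (fun j => (W j).1) fun j => (W j).2 := by
  refine Recognizable.congr (Recognizable.and (Recognizable.and ?_ (Recognizable.and ?_ ?_)) ?_)
    fun k W => oddAccepts_iff
  · exact Recognizable.any fun _ => True
  · exact Recognizable.first fun c : Layer B w × Option B => c.2 ≠ none
  · exact Recognizable.succ fun c d : Layer B w × Option B => c.2 = none → d.2 = none
  · exact Recognizable.exists <|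
      (Recognizable.all fun c : (Layer B w × Option B) × Fin w × Fin w =>
        (c.2.1, c.1.2, c.2.2) ∈ c.1.1.trans).and <|
      (Recognizable.succ fun c d : (Layer B w × Option B) × Fin w × Fin w => c.2.2 = d.2.1).and <|
      (Recognizable.first fun c : (Layer B w × Option B) × Fin w × Fin w =>
        c.2.1 ∈ c.1.1.init).and
      (Recognizable.last fun c : (Layer B w × Option B) × Fin w × Fin w =>
        c.2.2 ∈ c.1.1.final)

theorem recognizable_isODD [Finite B] :
    Recognizable fun k (D : Fin k → Layer B w) => IsODD D := by
  have h := (Recognizable.any fun _ : Layer B w => True).and <|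
    (Recognizable.succ fun c d : Layer B w => d.left = c.right).and <|
    (Recognizable.first fun c : Layer B w => c.initFlag = true).and <|
    (Recognizable.succ fun _ c : Layer B w => c.initFlag ≠ true).and <|
    (Recognizable.last fun c : Layer B w => c.finalFlag = true).and
    (Recognizable.succ fun c _ : Layer B w => c.finalFlag ≠ true)
  refine h.congr fun k D => ⟨fun hD => ?_, fun hD => ?_⟩
  · refine ⟨⟨⟨0, hD.pos⟩, trivial⟩, hD.frontier, fun i => (hD.initFlag i).2,
      fun i j hij => ?_, fun i => (hD.finalFlag i).2, fun i j hij => ?_⟩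
    · rw [Ne, hD.initFlag]
      omega
    · rw [Ne, hD.finalFlag]
      omega
  · obtain ⟨⟨i₀, -⟩, h1, h2, h3, h4, h5⟩ := hD
    refine ⟨i₀.pos, h1, fun i => ⟨fun hi => ?_, h2 i⟩, fun i => ⟨fun hi => ?_, h4 i⟩⟩
    · by_contra h0
      exact h3 ⟨i - 1, by omega⟩ i (Nat.sub_add_cancel (Nat.pos_of_ne_zero h0)) hi
    · by_contra hk
      exact h5 i ⟨i + 1, by omega⟩ rfl hi

/-- The tensor product has no padding only if all factors have the same length; then it is a
transposition of the tuple of strings. -/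
theorem tensorStr_eq_embedStr_iff {a : ℕ} (ha : 0 < a) {s : Fin a → List B}
    {t : List (Fin a → B)} :
    tensorStr s = embedStr t ↔ ∀ i, s i = t.map fun c => c i := by
  constructor
  · intro h i
    have hlen : (Finset.univ.sup fun i => (s i).length) = t.length := by
      simpa [tensorStr, embedStr] using congrArg List.length h
    refine List.ext_getElem? fun j => ?_
    rcases lt_or_ge j t.length with hj | hj
    · have := congrArg (fun l => l[j]?) h
      simp only [tensorStr, embedStr, List.getElem?_ofFn, List.getElem?_map] at this
      rw [dif_pos (by rw [hlen]; exact hj), List.getElem?_eq_getElem hj, Option.map_some,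
        Option.some_inj] at this
      have := congrFun this i
      rw [List.getElem?_map, List.getElem?_eq_getElem hj]
      exact this
    · have h1 : (s i).length ≤ t.length := by
        rw [← hlen]
        exact Finset.le_sup (f := fun i => (s i).length) (Finset.mem_univ i)
      rw [List.getElem?_eq_none (h1.trans hj), List.getElem?_eq_none (by simpa using hj)]
  · intro h
    have hlen : (Finset.univ.sup fun i => (s i).length) = t.length := by
      have h1 : ∀ i, (s i).length = t.length := fun i => by simp [h i]
      refine le_antisymm (Finset.sup_le fun i _ => (h1 i).le) ?_
      rw [← h1 ⟨0, ha⟩]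
      exact Finset.le_sup (f := fun i => (s i).length) (Finset.mem_univ _)
    refine List.ext_getElem? fun j => ?_
    simp only [tensorStr, embedStr, List.getElem?_ofFn, List.getElem?_map, hlen]
    split_ifs with hj
    · rw [List.getElem?_eq_getElem hj, Option.map_some, Option.some_inj]
      funext i
      rw [h i, List.getElem?_map, Fin.val_cast, List.getElem?_eq_getElem hj]
      rfl
    · rw [List.getElem?_eq_none (not_lt.1 hj)]
      rfl

/-- Membership in the relation associated with an ODD, in terms of padded strings. -/
theorem mem_assocRel_oddLang_iff {a k : ℕ} (ha : 0 < a) {D : Fin k → Layer (Fin a → B) w}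
    {s : Fin a → List B} (hs : ∀ i, s i ≠ [] ∧ (s i).length ≤ k) :
    s ∈ assocRel (oddLang D) ↔ ∃ v : Fin k → Option (Fin a → B), OddAccepts D v ∧
      ∀ j i, padStr k (s i) j = (v j).map fun c => c i := by
  constructor
  · rintro ⟨-, t, ht, h⟩
    rw [tensorStr_eq_embedStr_iff ha] at h
    refine ⟨padStr k t, ⟨t, ht, rfl⟩, fun j i => ?_⟩
    rw [h i, padStr_map]
  · rintro ⟨_, ⟨t, ht, rfl⟩, h⟩
    refine ⟨fun i => (hs i).1, t, ht, (tensorStr_eq_embedStr_iff ha).2 fun i => ?_⟩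
    refine padStr_injOn (hs i).2 (by simpa using ht.2.1) ?_
    rw [padStr_map]
    exact funext fun j => h j i

/-- Inclusion of the language of an ODD in a tensor power, in terms of padded strings. -/
theorem embedStr_image_subset_tensorPow_iff {a k : ℕ} (ha : 0 < a) {D : Fin k → Layer B w}
    {D' : Fin k → Layer (Fin a → B) w} :
    embedStr '' oddLang D' ⊆ tensorPow (oddLang D) a ↔
      ∀ v : Fin k → Option (Fin a → B), OddAccepts D' v →
        ∀ i, OddAccepts D fun j => (v j).map fun c => c i := by
  constructor
  · rintro h _ ⟨t, ht, rfl⟩ i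
    obtain ⟨s, hs, hst⟩ := h ⟨t, ht, rfl⟩
    rw [← padStr_map, ← (tensorStr_eq_embedStr_iff ha).1 hst.symm i]
    exact ⟨_, hs i, rfl⟩
  · rintro h _ ⟨t, ht, rfl⟩
    refine ⟨fun i => t.map fun c => c i, fun i => ?_,
      ((tensorStr_eq_embedStr_iff ha).2 fun i => rfl).symm⟩
    have := h _ ⟨t, ht, rfl⟩ i
    rwa [← padStr_map, oddAccepts_padStr (by simpa using ht.2.1)] at this

end DecisionDiagrams

section StructuralTuples

variable {A : Type u} [Finite A] {w : ℕ} {τ : Vocabulary}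

theorem recognizable_isStructural :
    Recognizable fun k (S : Fin k → StructLayer A w τ) => IsStructural S := by
  have h1 : Recognizable fun k (S : Fin k → StructLayer A w τ) => IsODD (domODD S) :=
    recognizable_isODD.comap Prod.fst
  have h2 : Recognizable fun k (S : Fin k → StructLayer A w τ) => ∀ i, IsODD (relODD S i) :=
    Recognizable.forall_finite fun i => recognizable_isODD.comap
      fun c : StructLayer A w τ => c.2 i
  have h3 : Recognizable fun k (S : Fin k → StructLayer A w τ) =>
      ∀ i, ∀ v : Fin k → Option (Fin (τ.arity i) → A), OddAccepts (relODD S i) v →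
        ∀ m, OddAccepts (domODD S) fun j => (v j).map fun c => c m := by
    refine Recognizable.forall_finite fun i => ?_
    have hr := recognizable_oddAccepts.comap
      fun z : StructLayer A w τ × Option (Fin (τ.arity i) → A) => (z.1.2 i, z.2)
    have hd := Recognizable.forall_finite fun m => recognizable_oddAccepts.comap
      fun z : StructLayer A w τ × Option (Fin (τ.arity i) → A) => (z.1.1, z.2.map fun c => c m)
    exact (hr.imp hd).forall
  refine (h1.and (h2.and h3)).congr fun k S => ⟨fun h => ⟨h.dom, h.rel, fun i => ?_⟩,
    fun h => ⟨h.1, h.2.1, fun i => ?_⟩⟩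
  · exact (embedStr_image_subset_tensorPow_iff (τ.arity_pos i)).1 (h.subset i)
  · exact (embedStr_image_subset_tensorPow_iff (τ.arity_pos i)).2 (h.2.2 i)

theorem recognizable_oddLang_nonempty :
    Recognizable fun k (S : Fin k → StructLayer A w τ) => (oddLang (domODD S)).Nonempty := by
  refine (recognizable_oddAccepts.comap fun z : StructLayer A w τ × Option A =>
    (z.1.1, z.2)).exists.congr fun k S => ⟨?_, ?_⟩
  · rintro ⟨s, hs⟩
    exact ⟨padStr k s, s, hs, rfl⟩
  · rintro ⟨_, s, hs, -⟩
    exact ⟨s, hs⟩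

end StructuralTuples

/-! ### First-order logic on derived structures -/

section DerivedStructures

variable {A : Type u} {w : ℕ} {τ : Vocabulary} {g b : ℕ}

/-- Interpretation of the atoms for the structure derived from a string of tuples of layers: the
elements are padded strings. Letters are numbered by `eG` and `eA`. The number of arguments is
uniform: at least the largest arity, and at least the two that equality needs. -/
def foInterp (eG : StructLayer A w τ ≃ Fin g) (eA : Option A ≃ Fin b) :
    Interp (Fin g) (Fin b) (Finset.univ.sup τ.arity + 2) := fun t _ W =>
  let S := fun j => eG.symm (W j).1
  if t = 1 then OddAccepts (domODD S) fun j => eA.symm ((W j).2 0)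
  else if t = 3 then ∀ j, (W j).2 0 = (W j).2 1
  else ∃ i : Fin τ.numRel, i + 4 = t ∧ ∃ v, OddAccepts (relODD S i) v ∧
    ∀ j (m : Fin (τ.arity i)), eA.symm ((W j).2 (m.castLE
      ((Finset.le_sup (Finset.mem_univ i)).trans (Nat.le_add_right _ 2)))) =
        (v j).map fun c => c m

theorem recognizable_foInterp [Finite A] (eG : StructLayer A w τ ≃ Fin g)
    (eA : Option A ≃ Fin b) (t : ℕ) : Recognizable (foInterp eG eA t) := by
  by_cases h1 : t = 1
  · refine (recognizable_oddAccepts.comap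
      fun c : Fin g × (Fin (Finset.univ.sup τ.arity + 2) → Fin b) =>
        ((eG.symm c.1).1, eA.symm (c.2 0))).congr fun k W => ?_
    simp only [foInterp, if_pos h1]
    rfl
  by_cases h3 : t = 3
  · refine (Recognizable.all
      fun c : Fin g × (Fin (Finset.univ.sup τ.arity + 2) → Fin b) => c.2 0 = c.2 1).congr
        fun k W => ?_
    simp only [foInterp, if_neg h1, if_pos h3]
  have h : ∀ i : Fin τ.numRel, Recognizable
      fun k (W : Fin k → Fin g × (Fin (Finset.univ.sup τ.arity + 2) → Fin b)) =>
        i + 4 = t → ¬ ∃ v, OddAccepts (relODD (fun j => eG.symm (W j).1) i) v ∧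
          ∀ j (m : Fin (τ.arity i)), eA.symm ((W j).2 (m.castLE
            ((Finset.le_sup (Finset.mem_univ i)).trans (Nat.le_add_right _ 2)))) =
              (v j).map fun c => c m := by
    intro i
    by_cases hi : i + 4 = t
    · refine (Recognizable.exists (Recognizable.and (recognizable_oddAccepts.comap
        fun c : (Fin g × (Fin (Finset.univ.sup τ.arity + 2) → Fin b)) ×
          Option (Fin (τ.arity i) → A) => ((eG.symm c.1.1).2 i, c.2))
        (Recognizable.all fun c : (Fin g × (Fin (Finset.univ.sup τ.arity + 2) → Fin b)) ×
          Option (Fin (τ.arity i) → A) => ∀ m : Fin (τ.arity i), eA.symm (c.1.2 (m.castLE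
            ((Finset.le_sup (Finset.mem_univ i)).trans (Nat.le_add_right _ 2)))) =
              c.2.map fun c => c m))).not.congr fun k W => ?_
      simp only [hi, true_imp_iff]
      rfl
    · exact Recognizable.false.not.congr fun k W => by simp [hi]
  refine (Recognizable.forall_finite h).not.congr fun k W => ?_
  simp only [foInterp, if_neg h1, if_neg h3]
  simp only [not_forall, not_not, exists_prop]

theorem foInterp_eq_false {eG : StructLayer A w τ ≃ Fin g} {eA : Option A ≃ Fin b} {t : ℕ}
    (ht : τ.numRel + 4 ≤ t) (k : ℕ) (W) : ¬ foInterp eG eA t k W := by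
  rw [foInterp, if_neg (by omega), if_neg (by omega)]
  rintro ⟨i, hi, -⟩
  omega

theorem exists_eq_var {L : FirstOrder.Language} [L.IsRelational] {n : ℕ}
    (t : L.Term (Empty ⊕ Fin n)) : ∃ i : Fin n, t = .var (.inr i) := by
  rcases t with (z | i) | ⟨f, _⟩
  · exact z.elim
  · exact ⟨i, rfl⟩
  · exact isEmptyElim f

/-- A first-order formula holds in the derived structure if and only if its Gödel number is
satisfied by the padded strings. -/
theorem sat_foCode_iff [NeZero b] (eG : StructLayer A w τ ≃ Fin g) (eA : Option A ≃ Fin b) {k : ℕ}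
    (S : Fin k → StructLayer A w τ) {n : ℕ} (φ : τ.language.BoundedFormula Empty n)
    (xs : Fin n → oddLang (domODD S)) (m : ℕ) (e E : ℕ → Fin k → Fin b)
    (he : ∀ i : Fin n, e i = fun j => eA (padStr k (xs i : List A) j)) :
    (foInterp eG eA).Sat (fun j => eG (S j)) (foCode (vocabRelCode τ) φ) n m e E ↔
      letI := derivedStructure S
      φ.Realize default xs := by
  let _ := derivedStructure S
  induction φ generalizing e with
  | falsum =>
    rw [foCode, Interp.sat_falsum]
    simp [Interp.Holds, foInterp, FirstOrder.Language.BoundedFormula.Realize]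
  | equal t₁ t₂ =>
    obtain ⟨i₁, rfl⟩ := exists_eq_var t₁
    obtain ⟨i₂, rfl⟩ := exists_eq_var t₂
    rw [foCode, Interp.sat_equal, FirstOrder.Language.BoundedFormula.Realize]
    simp only [Interp.Holds, foInterp, termCode, he]
    simp
    rw [← funext_iff]
    exact ⟨fun h => Subtype.ext (padStr_injOn (xs i₁).2.2.1 (xs i₂).2.2.1 h), fun h => by rw [h]⟩
  | @rel n l R ts =>
    obtain ⟨r⟩ := R
    choose f hf using fun j => exists_eq_var (ts j)
    obtain rfl : ts = fun j => .var (.inr (f j)) := funext hf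
    change (foInterp eG eA).Sat _ (Nat.pair 2 (Nat.pair r (Encodable.encode
        (List.ofFn fun j => (f j : ℕ))))) n m e E ↔
      (fun j => (xs (f j) : List A)) ∈ assocRel (oddLang (relODD S r))
    rw [Interp.sat_rel, mem_assocRel_oddLang_iff (τ.arity_pos r) fun i =>
      ⟨(xs (f i)).2.1, (xs (f i)).2.2.1⟩]
    simp only [Interp.Holds, foInterp]
    rw [if_neg (by omega), if_neg (by omega)]
    have harg : ∀ j (i : Fin (τ.arity r)),
        (((List.ofFn fun j => (f j : ℕ)).map e).map fun V => V j).getD (i : ℕ) default =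
          eA (padStr k (xs (f i) : List A) j) := by
      intro j i
      simp [he]
    constructor
    · rintro ⟨i, hi, v, hv, h⟩
      obtain rfl : i = r := Fin.ext (by omega)
      refine ⟨v, by simpa only [Equiv.symm_apply_apply] using hv, fun j i => ?_⟩
      rw [← h j i, Fin.val_castLE, harg, Equiv.symm_apply_apply]
    · rintro ⟨v, hv, h⟩
      refine ⟨r, rfl, v, by simpa only [Equiv.symm_apply_apply] using hv, fun j i => ?_⟩
      rw [← h j i, Fin.val_castLE, harg, Equiv.symm_apply_apply]
  | imp φ₁ φ₂ ih₁ ih₂ =>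
    exact Interp.sat_imp.trans (imp_congr (ih₁ xs e he) (ih₂ xs e he))
  | @all n φ ih =>
    rw [foCode, Interp.sat_all, FirstOrder.Language.BoundedFormula.Realize]
    have hupd : ∀ x : oddLang (domODD S), ∀ i : Fin (n + 1),
        Function.update e n (fun j => eA (padStr k (x : List A) j)) i =
          fun j => eA (padStr k ((Fin.snoc xs x : Fin (n + 1) → _) i : List A) j) := by
      intro x i
      refine Fin.lastCases ?_ (fun i => ?_) i
      · simp
      · simp [i.2.ne, he]
    constructor
    · intro h x
      refine (ih (Fin.snoc xs x) _ (hupd x)).1 (h _ ?_)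
      refine ⟨x, by simpa only [Equiv.symm_apply_apply] using x.2, ?_⟩
      funext j
      simp
    · rintro h V ⟨s, hs, hV⟩
      obtain rfl : V = fun j => eA (padStr k s j) := by
        funext j
        rw [← congrFun hV j]
        simp
      have hs' : s ∈ oddLang (domODD S) := by
        simpa only [Equiv.symm_apply_apply] using hs
      exact (ih (Fin.snoc xs ⟨s, hs'⟩) _ (hupd ⟨s, hs'⟩)).2 (h ⟨s, hs'⟩)

end DerivedStructures

/-! ### Monadic second-order logic on strings -/

section Strings

variable {G : Type u} {g : ℕ}

/-- The characteristic string of a set of positions. -/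
noncomputable def indicatorStr {k : ℕ} (B : Set (Fin k)) : Fin k → Fin 2 :=
  open Classical in fun j => if j ∈ B then 1 else 0

theorem indicatorStr_eq_one {k : ℕ} {B : Set (Fin k)} {j : Fin k} :
    indicatorStr B j = 1 ↔ j ∈ B := by
  simp [indicatorStr]

theorem eq_indicatorStr {k : ℕ} (V : Fin k → Fin 2) : V = indicatorStr {j | V j = 1} := by
  funext j
  by_cases h : V j = 1
  · rw [h]
    exact (indicatorStr_eq_one.2 h).symm
  · simp only [indicatorStr, Set.mem_ofPred_eq, if_neg h]
    omega

/-- Interpretation of the atoms for monadic second-order logic on strings: a position is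
represented by the characteristic string of its singleton, a set of positions by its characteristic
string. The letter `c` of the alphabet is the relation symbol `c + 1`, hence the atom `c + 5`. -/
def msoInterp (g : ℕ) : Interp (Fin g) (Fin 2) 2 := fun t _ W =>
  if t = 1 then (∃ j, (W j).2 0 = 1) ∧ ¬ ∃ i j, i < j ∧ (W i).2 0 = 1 ∧ (W j).2 0 = 1
  else if t = 2 then ∃ j, (W j).2 0 = 1 ∧ (W j).2 1 = 1
  else if t = 3 then ∀ j, (W j).2 0 = (W j).2 1
  else if t = 4 then ∃ i j, i < j ∧ (W i).2 0 = 1 ∧ (W j).2 1 = 1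
  else ∃ j, (W j).1 + 5 = t ∧ (W j).2 0 = 1

theorem recognizable_msoInterp (g t : ℕ) : Recognizable (msoInterp g t) := by
  unfold msoInterp
  split_ifs
  · exact (Recognizable.any fun c : Fin g × (Fin 2 → Fin 2) => c.2 0 = 1).and
      (Recognizable.any_lt (fun c : Fin g × (Fin 2 → Fin 2) => c.2 0 = 1)
        fun c => c.2 0 = 1).not
  · exact Recognizable.any fun c : Fin g × (Fin 2 → Fin 2) => c.2 0 = 1 ∧ c.2 1 = 1
  · exact Recognizable.all fun c : Fin g × (Fin 2 → Fin 2) => c.2 0 = c.2 1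
  · exact Recognizable.any_lt (fun c : Fin g × (Fin 2 → Fin 2) => c.2 0 = 1) fun c => c.2 1 = 1
  · exact Recognizable.any fun c : Fin g × (Fin 2 → Fin 2) => c.1 + 5 = t ∧ c.2 0 = 1

theorem msoInterp_eq_false {t : ℕ} (ht : g + 5 ≤ t) (k : ℕ) (W) : ¬ msoInterp g t k W := by
  rw [msoInterp, if_neg (by omega), if_neg (by omega), if_neg (by omega), if_neg (by omega)]
  rintro ⟨j, hj, -⟩
  omega

/-- A monadic second-order formula holds in a string if and only if its Gödel number is satisfied
by the characteristic strings. -/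
theorem sat_msoCode_iff [Finite G] {k : ℕ} (S : Fin k → G) {n m : ℕ}
    (ψ : MSO (stringLanguage G) n m) (xs : Fin n → Fin k) (Xs : Fin m → Set (Fin k))
    (e E : ℕ → Fin k → Fin 2) (he : ∀ i : Fin n, e i = indicatorStr {xs i})
    (hE : ∀ i : Fin m, E i = indicatorStr (Xs i)) :
    (msoInterp (Nat.card G)).Sat (fun j => Finite.equivFin G (S j)) (ψ.code (stringRelCode G))
        n m e E ↔
      letI := stringStructure S
      ψ.Realize xs Xs := by
  let _ := stringStructure S
  induction ψ generalizing e E with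
  | falsum =>
    refine Interp.sat_falsum.trans ?_
    simp [Interp.Holds, msoInterp, MSO.Realize]
  | equal x y =>
    refine Interp.sat_equal.trans ?_
    simp [Interp.Holds, msoInterp, MSO.Realize, he]
    constructor
    · intro h
      exact indicatorStr_eq_one.1 ((h (xs x)).symm.trans (indicatorStr_eq_one.2 rfl))
    · intro h j
      rw [h]
  | mem x X =>
    refine Interp.sat_mem.trans ?_
    simp [Interp.Holds, msoInterp, MSO.Realize, he, hE, indicatorStr_eq_one]
  | rel R f =>
    cases R with
    | lt =>
      refine Interp.sat_rel.trans ?_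
      change _ ↔ xs (f 0) < xs (f 1)
      simp [Interp.Holds, msoInterp, he, indicatorStr_eq_one, stringRelCode, List.ofFn_succ]
    | letter c =>
      refine Interp.sat_rel.trans ?_
      change _ ↔ S (xs (f 0)) = c
      simp [Interp.Holds, msoInterp, he, indicatorStr_eq_one, stringRelCode, List.ofFn_succ]
      rw [← Fin.ext_iff]
      exact (Finite.equivFin G).injective.eq_iff
  | imp φ₁ φ₂ ih₁ ih₂ =>
    exact Interp.sat_imp.trans (imp_congr (ih₁ xs Xs e E he hE) (ih₂ xs Xs e E he hE))
  | @all n m φ ih =>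
    refine Interp.sat_all.trans ?_
    change _ ↔ ∀ x : Fin k, _
    have hupd : ∀ x : Fin k, ∀ i : Fin (n + 1),
        Function.update e n (indicatorStr {x}) i =
          indicatorStr {(Fin.snoc xs x : Fin (n + 1) → Fin k) i} := by
      intro x i
      refine Fin.lastCases ?_ (fun i => ?_) i
      · simp
      · simp [i.2.ne, he]
    constructor
    · intro h x
      refine (ih (Fin.snoc xs x) Xs _ E (hupd x) hE).1 (h _ ?_)
      simp [Interp.Holds, msoInterp, indicatorStr_eq_one]
    · intro h V hV
      obtain ⟨x, rfl⟩ : ∃ x, V = indicatorStr {x} := by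
        simp only [Interp.Holds, msoInterp] at hV
        simp at hV
        obtain ⟨⟨x, hx⟩, hlt⟩ := hV
        refine ⟨x, ?_⟩
        rw [eq_indicatorStr V]
        congr 1
        ext j
        refine ⟨fun hj => ?_, fun hj => ?_⟩
        · rcases lt_trichotomy j x with h | h | h
          · exact (hlt _ _ h hj hx).elim
          · exact h
          · exact (hlt _ _ h hx hj).elim
        · obtain rfl : j = x := hj
          exact hx
      exact (ih (Fin.snoc xs x) Xs _ E (hupd x) hE).2 (h x)
  | @allSet n m φ ih =>
    refine Interp.sat_allSet.trans ?_
    change _ ↔ ∀ B : Set (Fin k), _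
    have hupd : ∀ B : Set (Fin k), ∀ i : Fin (m + 1),
        Function.update E m (indicatorStr B) i =
          indicatorStr ((Fin.snoc Xs B : Fin (m + 1) → Set (Fin k)) i) := by
      intro x i
      refine Fin.lastCases ?_ (fun i => ?_) i
      · simp
      · simp [i.2.ne, hE]
    constructor
    · intro h B
      exact (ih xs (Fin.snoc Xs B) e _ he (hupd B)).1 (h _)
    · intro h V
      rw [eq_indicatorStr V]
      exact (ih xs (Fin.snoc Xs _) e _ he (hupd _)).2 (h _)

end Strings

/-! ### Decidability -/

theorem nonempty_layer {B : Type*} {w : ℕ} : Nonempty (Layer B w) :=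
  ⟨⟨∅, ∅, ∅, ∅, ∅, true, true, by simp, by simp, by simp, by simp, by simp⟩⟩

theorem theorem3 {A : Type u} [Finite A] [Nonempty A] (w : ℕ) (hw : 0 < w) (τ : Vocabulary) :
    ∃ P : ℕ × ℕ → Prop, ComputablePred P ∧
      ∀ (ψ : MSO.Sentence (stringLanguage (StructLayer A w τ))) (φ : τ.language.Sentence),
        P (msoNumber ψ, foNumber φ) ↔
          ∃ (k : ℕ) (S : Fin k → StructLayer A w τ),
            IsStructural S ∧ (oddLang (domODD S)).Nonempty ∧
              StringModels S ψ ∧ DerivedModels S φ := by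
  let eG := Finite.equivFin (StructLayer A w τ)
  let eA := Finite.equivFin (Option A)
  have : Nonempty (StructLayer A w τ) := ⟨nonempty_layer.some, fun _ => nonempty_layer.some⟩
  have : NeZero (Nat.card (StructLayer A w τ)) := ⟨Nat.card_pos.ne'⟩
  have : NeZero (Nat.card (Option A)) := ⟨Nat.card_pos.ne'⟩
  have hQ : Recognizable fun k (S : Fin k → Fin (Nat.card (StructLayer A w τ))) =>
      IsStructural (fun j => eG.symm (S j)) ∧
        (oddLang (domODD fun j => eG.symm (S j))).Nonempty :=
    (recognizable_isStructural.and recognizable_oddLang_nonempty).comap eG.symm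
  refine ⟨_, (Interp.primrecPred_exists_sat hQ (msoInterp _) (recognizable_msoInterp _)
    (fun t ht => msoInterp_eq_false ht) (foInterp eG eA) (recognizable_foInterp eG eA)
    (fun t ht => foInterp_eq_false ht)).computablePred, fun ψ φ => ?_⟩
  have hiff : ∀ (k : ℕ) (S : Fin k → StructLayer A w τ),
      (msoInterp _).Sat (fun j => eG (S j)) (msoNumber ψ) 0 0 default default ∧
        (foInterp eG eA).Sat (fun j => eG (S j)) (foNumber φ) 0 0 default default ↔
      StringModels S ψ ∧ DerivedModels S φ := fun k S =>
    and_congr (sat_msoCode_iff S ψ _ _ _ _ (fun i => i.elim0) fun i => i.elim0)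
      (sat_foCode_iff eG eA S φ _ 0 _ _ fun i => i.elim0)
  constructor
  · rintro ⟨k, S, ⟨h1, h2⟩, h3⟩
    refine ⟨k, fun j => eG.symm (S j), h1, h2, (hiff k _).1 ?_⟩
    simpa only [Equiv.apply_symm_apply] using h3
  · rintro ⟨k, S, h1, h2, h3⟩
    refine ⟨k, fun j => eG (S j), ?_, (hiff k S).2 h3⟩
    simp only [Equiv.symm_apply_apply]
    exact ⟨h1, h2⟩
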